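/- Let $\Omega\subseteq\mathbb{R}^d$ be open and $p,q\in[1,\infty]$. Write $\omega\Subset\Omega$ if $\omega$ is open with compact closure contained in $\Omega$, and $\|g\|_{W^{k,p}(\omega)}=\max_{|\alpha|\le k}\|g^{(\alpha)}\|_{L^p(\omega)}$. Let $\mathcal{E}_q(\Omega)$ be the space of nets $(f_\varepsilon)_{\varepsilon\in(0,1)}\in C((0,1);C^\infty(\Omega))$ such that for all $k\in\mathbb{N}_0$ and $\omega\Subset\Omega$ there is $s\in\mathbb{R}$ with $$\int_0^1\varepsilon^{qs}\|f_\varepsilon\|_{W^{k,p}(\omega)}^q\,\frac{d\varepsilon}{\varepsilon}<\infty \qquad(\ast)$$ (for $q=\infty$: $\sup_{\varepsilon\in(0,1)}\varepsilon^{s}\|f_\varepsilon\|_{W^{k,p}(\omega)}<\infty$), let $\mathcal{N}_q(\Omega)$ be the space of those nets in $C((0,1);C^\infty(\Omega))$ for which $(\ast)$ holds for all $k$, $\omega\Subset\Omega$ and $s\in\mathbb{R}$, and put $\mathcal{G}_q(\Omega)=\mathcal{E}_q(\Omega)/\mathcal{N}_q(\Omega)$. Let $\mathcal{G}^\infty_q(\Omega)$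 be the set of all $u\in\mathcal{G}_q(\Omega)$ such that for every $\omega\Subset\Omega$ there is $s\in\mathbb{R}$ such that for every $k\in\mathbb{N}_0$ the restriction $u_{|\omega}$ has a representative $(f_\varepsilon)_\varepsilon\in\mathcal{E}_q(\omega)$ with $\int_0^1\varepsilon^{qs}\|f_\varepsilon\|_{W^{k,p}(\omega')}^q\frac{d\varepsilon}{\varepsilon}<\infty$ for all $\omega'\Subset\omega$ (with the same change when $q=\infty$). Let $\phi\in\mathcal{S}(\mathbb{R}^d)$ satisfy $\int\phi=1$ and $\int x^\alpha\phi(x)\,dx=0$ for all $\alpha\in\mathbb{N}_0^d\setminus\{0\}$, let $\phi_\varepsilon=\varepsilon^{-d}\phi(\cdot/\varepsilon)$, and let $\iota:\mathcal{D}'(\Omega)\to\mathcal{G}_q(\Omega)$ be the embedding for which $u=\iota(T)$ if and only if, for every open $\omega\subseteq\Omega$ and every $\chi\in\mathcal{D}(\Omega)$ with $\chi=1$ on $\omega$, the net $(((\chi T)\ast\phi_\varepsilon)_{|\omega})_\varepsilon$ belongs to $\mathcal{E}_q(\omega)$ and represents $u_{|\omega}$. Then $\iota$ is well defined (for every $T\in\mathcal{D}'(\Omega)$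 there is exactly one such $u$), and $$\iota(\mathcal{D}'(\Omega))\cap\mathcal{G}^\infty_q(\Omega)=\iota(C^\infty(\Omega)),$$ where $C^\infty(\Omega)$ is regarded as a subspace of $\mathcal{D}'(\Omega)$. Moreover, every $T\in\mathcal{D}'(\Omega)$ with $\iota(T)\in\mathcal{G}^\infty_q(\Omega)$ is a smooth function, $T\in C^\infty(\Omega)$. -/

import Mathlib

open MeasureTheory Set TopologicalSpace
open scoped ENNReal NNReal ContDiff Distributions SchwartzMap

namespace LqColombeau

/-- The Euclidean space of dimension `d`. -/
abbrev RSp (d : ℕ) : Type := EuclideanSpace ℝ (Fin d)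

/-- A net of functions; only the values at `(ε, x)` with `ε ∈ (0, 1)` and `x ∈ Ω` matter. -/
abbrev Net (d : ℕ) : Type := ℝ → RSp d → ℂ

variable {d : ℕ}

/-! ### Sobolev norms and `L^q` growth conditions -/

/-- The partial derivative `∂_{m 0} ⋯ ∂_{m (j-1)} g`. -/
noncomputable def pderiv {j : ℕ} (m : Fin j → Fin d) (g : RSp d → ℂ) (x : RSp d) : ℂ :=
  iteratedFDeriv ℝ j g x (fun i => EuclideanSpace.single (m i) (1 : ℝ))

/-- `‖g‖_{W^{k,p}(U)}`: the maximum of the `L^p(U)` norms of all partial derivatives of order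
at most `k`. -/
noncomputable def sobolevNorm (k : ℕ) (p : ℝ≥0∞) (U : Set (RSp d)) (g : RSp d → ℂ) : ℝ≥0∞ :=
  ⨆ j : Fin (k + 1), ⨆ m : Fin j → Fin d, eLpNorm (pderiv m g) p (volume.restrict U)

/-- The measure `dε / ε` on `(0, 1)`. -/
noncomputable def dlog : Measure ℝ :=
  (volume.restrict (Ioo (0 : ℝ) 1)).withDensity fun ε => ENNReal.ofReal ε⁻¹

/-- The `L^q((0,1), dε/ε)` norm of `ε ↦ ε^s ‖f_ε‖_{W^{k,p}(U)}`, that is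
`(∫_0^1 ε^{qs} ‖f_ε‖^q dε/ε)^{1/q}` for `q < ∞` and the (essential) supremum for `q = ∞`. -/
noncomputable def growthNorm (p q : ℝ≥0∞) (k : ℕ) (s : ℝ) (U : Set (RSp d)) (f : Net d) : ℝ≥0∞ :=
  eLpNorm (fun ε : ℝ => ENNReal.ofReal (ε ^ s) * sobolevNorm k p U (f ε)) q dlog

/-- `U ⋐ Ω`: the set `U` is open and has compact closure inside `Ω`. -/
def RelCompact (U Ω : Opens (RSp d)) : Prop :=
  IsCompact (closure (U : Set (RSp d))) ∧ closure (U : Set (RSp d)) ⊆ (Ω : Set (RSp d))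

/-- The net `ε ↦ f_ε` belongs to `C((0,1); C^∞(Ω))`: every `f_ε` is smooth on `Ω`, and all
derivatives in `x` are continuous functions of `(ε, x) ∈ (0,1) × Ω`. -/
structure IsSmoothNet (Ω : Opens (RSp d)) (f : Net d) : Prop where
  smooth : ∀ ε ∈ Ioo (0 : ℝ) 1, ContDiffOn ℝ ∞ (f ε) Ω
  cont : ∀ j : ℕ, ContinuousOn (fun z : ℝ × RSp d => iteratedFDeriv ℝ j (f z.1) z.2)
    (Ioo (0 : ℝ) 1 ×ˢ (Ω : Set (RSp d)))

/-- Nets of smooth functions with `L^q`-moderate growth. -/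
def IsModerate (p q : ℝ≥0∞) (Ω : Opens (RSp d)) (f : Net d) : Prop :=
  IsSmoothNet Ω f ∧ ∀ (k : ℕ) (U : Opens (RSp d)), RelCompact U Ω →
    ∃ s : ℝ, growthNorm p q k s U f < ⊤

/-- `L^q`-negligible nets of smooth functions. -/
def IsNegligible (p q : ℝ≥0∞) (Ω : Opens (RSp d)) (f : Net d) : Prop :=
  IsSmoothNet Ω f ∧ ∀ (k : ℕ) (U : Opens (RSp d)), RelCompact U Ω →
    ∀ s : ℝ, growthNorm p q k s U f < ⊤

/-! ### Moderate and negligible nets form vector spaces -/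

theorem IsSmoothNet.contDiffAt {Ω : Opens (RSp d)} {f : Net d} (hf : IsSmoothNet Ω f)
    {ε : ℝ} (hε : ε ∈ Ioo (0 : ℝ) 1) {x : RSp d} (hx : x ∈ Ω) (j : ℕ) :
    ContDiffAt ℝ j (f ε) x :=
  ((hf.smooth ε hε).contDiffAt (Ω.isOpen.mem_nhds hx)).of_le (by exact_mod_cast le_top)

theorem IsSmoothNet.add {Ω : Opens (RSp d)} {f g : Net d} (hf : IsSmoothNet Ω f)
    (hg : IsSmoothNet Ω g) : IsSmoothNet Ω (f + g) := by
  refine ⟨fun ε hε => (hf.smooth ε hε).add (hg.smooth ε hε), fun j => ?_⟩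
  refine ((hf.cont j).add (hg.cont j)).congr fun z hz => ?_
  exact iteratedFDeriv_add_apply (hf.contDiffAt hz.1 hz.2 j) (hg.contDiffAt hz.1 hz.2 j)

theorem IsSmoothNet.smul {Ω : Opens (RSp d)} {f : Net d} (c : ℂ) (hf : IsSmoothNet Ω f) :
    IsSmoothNet Ω (c • f) := by
  refine ⟨fun ε hε => (hf.smooth ε hε).const_smul c, fun j => ?_⟩
  have h : ContinuousOn (fun z : ℝ × RSp d => c • iteratedFDeriv ℝ j (f z.1) z.2)
      (Ioo (0 : ℝ) 1 ×ˢ (Ω : Set (RSp d))) := ContinuousOn.const_smul (hf.cont j) c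
  refine h.congr fun z hz => ?_
  exact iteratedFDeriv_const_smul_apply (a := c) (hf.contDiffAt hz.1 hz.2 j)

theorem IsSmoothNet.zero (Ω : Opens (RSp d)) : IsSmoothNet Ω (0 : Net d) := by
  refine ⟨fun ε _ => contDiffOn_const, fun j => ?_⟩
  refine (continuousOn_const (c := 0)).congr fun z _ => ?_
  change iteratedFDeriv ℝ j (fun _ : RSp d => (0 : ℂ)) z.2 = 0
  rw [iteratedFDeriv_fun_zero]; rfl

theorem IsSmoothNet.mono {Ω U : Opens (RSp d)} (h : U ≤ Ω) {f : Net d} (hf : IsSmoothNet Ω f) :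
    IsSmoothNet U f :=
  ⟨fun ε hε => (hf.smooth ε hε).mono h, fun j => (hf.cont j).mono (prod_mono le_rfl h)⟩

theorem IsSmoothNet.continuousOn_pderiv {Ω : Opens (RSp d)} {f : Net d} (hf : IsSmoothNet Ω f)
    {j : ℕ} (m : Fin j → Fin d) :
    ContinuousOn (fun z : ℝ × RSp d => pderiv m (f z.1) z.2)
      (Ioo (0 : ℝ) 1 ×ˢ (Ω : Set (RSp d))) :=
  (ContinuousMultilinearMap.apply ℝ (fun _ : Fin j => RSp d) ℂ
    (fun i => EuclideanSpace.single (m i) (1 : ℝ))).continuous.comp_continuousOn (hf.cont j)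

theorem IsSmoothNet.continuousOn_pderiv_right {Ω : Opens (RSp d)} {f : Net d}
    (hf : IsSmoothNet Ω f) {j : ℕ} (m : Fin j → Fin d) {ε : ℝ} (hε : ε ∈ Ioo (0 : ℝ) 1) :
    ContinuousOn (pderiv m (f ε)) (Ω : Set (RSp d)) :=
  (hf.continuousOn_pderiv m).comp (f := fun x : RSp d => (ε, x)) (by fun_prop)
    fun _ hx => ⟨hε, hx⟩

/-- The essential supremum of a continuous function on an open set is its supremum. -/
theorem eLpNorm_top_eq_iSup {U : Opens (RSp d)} {g : RSp d → ℂ}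
    (hg : ContinuousOn g (U : Set (RSp d))) :
    eLpNorm g ⊤ (volume.restrict (U : Set (RSp d))) = ⨆ x : U, ‖g x‖ₑ := by
  rw [eLpNorm_exponent_top, eLpNormEssSup_eq_essSup_enorm]
  apply le_antisymm
  · refine essSup_le_of_ae_le _ ?_
    filter_upwards [ae_restrict_mem U.isOpen.measurableSet] with x hx
    exact le_iSup (fun y : U => ‖g y‖ₑ) ⟨x, hx⟩
  · refine iSup_le fun x => ?_
    by_contra! hlt
    have hU : IsOpen ((U : Set (RSp d)) ∩ (fun y => ‖g y‖ₑ) ⁻¹'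
        Ioi (essSup (fun y => ‖g y‖ₑ) (volume.restrict (U : Set (RSp d))))) :=
      hg.enorm.isOpen_inter_preimage U.isOpen isOpen_Ioi
    have hpos := hU.measure_pos volume ⟨x, x.2, hlt⟩
    have hnull := meas_essSup_lt (μ := volume.restrict (U : Set (RSp d))) (f := fun y => ‖g y‖ₑ)
    rw [Measure.restrict_apply' U.isOpen.measurableSet, inter_comm] at hnull
    exact hpos.ne' hnull

theorem aemeasurable_eLpNorm {p : ℝ≥0∞} {U : Opens (RSp d)} {F : ℝ × RSp d → ℂ}
    (hF : ContinuousOn F (Ioo (0 : ℝ) 1 ×ˢ (U : Set (RSp d)))) :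
    AEMeasurable (fun ε : ℝ => eLpNorm (fun x => F (ε, x)) p (volume.restrict (U : Set (RSp d))))
      (volume.restrict (Ioo (0 : ℝ) 1)) := by
  rcases eq_or_ne p 0 with rfl | hp0
  · simp
  rcases eq_or_ne p ⊤ with rfl | hp
  · apply aemeasurable_restrict_of_measurable_subtype measurableSet_Ioo
    have h1 : (fun ε : Ioo (0 : ℝ) 1 =>
        eLpNorm (fun x => F (ε, x)) ⊤ (volume.restrict (U : Set (RSp d)))) =
        fun ε : Ioo (0 : ℝ) 1 => ⨆ x : U, ‖F (ε, x)‖ₑ := by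
      funext ε
      refine eLpNorm_top_eq_iSup (hF.comp (f := fun x : RSp d => ((ε : ℝ), x)) (by fun_prop)
        fun _ hx => ⟨ε.2, hx⟩)
    rw [h1]
    refine (lowerSemicontinuous_iSup fun x : U => ?_).measurable
    apply Continuous.lowerSemicontinuous
    refine continuous_enorm.comp ?_
    exact hF.comp_continuous (f := fun ε : Ioo (0 : ℝ) 1 => ((ε : ℝ), (x : RSp d)))
      (by fun_prop) fun ε => ⟨ε.2, x.2⟩
  · simp_rw [eLpNorm_eq_lintegral_rpow_enorm_toReal hp0 hp]
    refine AEMeasurable.pow_const ?_ _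
    have h2 : AEMeasurable (fun z : ℝ × RSp d => ‖F z‖ₑ ^ p.toReal)
        ((volume.restrict (Ioo (0 : ℝ) 1)).prod (volume.restrict (U : Set (RSp d)))) := by
      rw [Measure.prod_restrict]
      exact (hF.aestronglyMeasurable
        (measurableSet_Ioo.prod U.isOpen.measurableSet)).enorm.pow_const _
    exact h2.lintegral_prod_right'

theorem IsSmoothNet.aemeasurable_weight {U : Opens (RSp d)} {f : Net d} (hf : IsSmoothNet U f)
    (p : ℝ≥0∞) (k : ℕ) (s : ℝ) :
    AEMeasurable (fun ε : ℝ => ENNReal.ofReal (ε ^ s) * sobolevNorm k p U (f ε)) dlog := by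
  have h : AEMeasurable (fun ε : ℝ => ENNReal.ofReal (ε ^ s) * sobolevNorm k p U (f ε))
      (volume.restrict (Ioo (0 : ℝ) 1)) := by
    refine AEMeasurable.mul (by fun_prop) ?_
    unfold sobolevNorm
    refine AEMeasurable.iSup fun j => AEMeasurable.iSup fun m => ?_
    exact aemeasurable_eLpNorm (F := fun z => pderiv m (f z.1) z.2) (hf.continuousOn_pderiv m)
  exact h.mono_ac (withDensity_absolutelyContinuous _ _)

theorem ae_dlog_mem : ∀ᵐ ε ∂dlog, ε ∈ Ioo (0 : ℝ) 1 :=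
  (withDensity_absolutelyContinuous _ _).ae_le (ae_restrict_mem measurableSet_Ioo)

theorem le_sobolevNorm {k : ℕ} (j : Fin (k + 1)) (m : Fin j → Fin d) (p : ℝ≥0∞)
    (U : Set (RSp d)) (g : RSp d → ℂ) :
    eLpNorm (pderiv m g) p (volume.restrict U) ≤ sobolevNorm k p U g :=
  (le_iSup (fun m : Fin j → Fin d => eLpNorm (pderiv m g) p (volume.restrict U)) m).trans
    (le_iSup (fun j : Fin (k + 1) =>
      ⨆ m : Fin j → Fin d, eLpNorm (pderiv m g) p (volume.restrict U)) j)

theorem sobolevNorm_add_le {U : Opens (RSp d)} {f g : Net d} (hf : IsSmoothNet U f)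
    (hg : IsSmoothNet U g) (p : ℝ≥0∞) (k : ℕ) {ε : ℝ} (hε : ε ∈ Ioo (0 : ℝ) 1) :
    sobolevNorm k p U ((f + g) ε) ≤
      ENNReal.LpAddConst p * (sobolevNorm k p U (f ε) + sobolevNorm k p U (g ε)) := by
  refine iSup_le fun j => iSup_le fun m => ?_
  have h1 : eLpNorm (pderiv m ((f + g) ε)) p (volume.restrict (U : Set (RSp d))) =
      eLpNorm (pderiv m (f ε) + pderiv m (g ε)) p (volume.restrict (U : Set (RSp d))) := by
    refine eLpNorm_congr_ae ?_
    filter_upwards [ae_restrict_mem U.isOpen.measurableSet] with x hx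
    have := iteratedFDeriv_add_apply (hf.contDiffAt hε hx j) (hg.contDiffAt hε hx j)
    change iteratedFDeriv ℝ j (f ε + g ε) x _ = _
    rw [this]; rfl
  rw [h1]
  refine (eLpNorm_add_le' ((hf.continuousOn_pderiv_right m hε).aestronglyMeasurable
    U.isOpen.measurableSet) ((hg.continuousOn_pderiv_right m hε).aestronglyMeasurable
    U.isOpen.measurableSet) p).trans ?_
  gcongr
  · exact le_sobolevNorm j m p U (f ε)
  · exact le_sobolevNorm j m p U (g ε)

theorem sobolevNorm_smul_le {U : Opens (RSp d)} {f : Net d} (c : ℂ) (hf : IsSmoothNet U f)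
    (p : ℝ≥0∞) (k : ℕ) {ε : ℝ} (hε : ε ∈ Ioo (0 : ℝ) 1) :
    sobolevNorm k p U ((c • f) ε) ≤ ‖c‖ₑ * sobolevNorm k p U (f ε) := by
  refine iSup_le fun j => iSup_le fun m => ?_
  have h1 : eLpNorm (pderiv m ((c • f) ε)) p (volume.restrict (U : Set (RSp d))) =
      eLpNorm (c • pderiv m (f ε)) p (volume.restrict (U : Set (RSp d))) := by
    refine eLpNorm_congr_ae ?_
    filter_upwards [ae_restrict_mem U.isOpen.measurableSet] with x hx
    have := iteratedFDeriv_const_smul_apply (a := c) (hf.contDiffAt hε hx j)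
    change iteratedFDeriv ℝ j (c • f ε) x _ = _
    rw [this]; rfl
  rw [h1, eLpNorm_const_smul]
  gcongr
  exact le_sobolevNorm j m p U (f ε)

theorem growthNorm_add_lt_top {U : Opens (RSp d)} {f g : Net d} (hf : IsSmoothNet U f)
    (hg : IsSmoothNet U g) {p q : ℝ≥0∞} {k : ℕ} {s : ℝ} (hf' : growthNorm p q k s U f < ⊤)
    (hg' : growthNorm p q k s U g < ⊤) : growthNorm p q k s U (f + g) < ⊤ := by
  have hsum := eLpNorm_add_lt_top (μ := dlog) (p := q)
    (f := fun ε : ℝ => ENNReal.ofReal (ε ^ s) * sobolevNorm k p U (f ε))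
    (g := fun ε : ℝ => ENNReal.ofReal (ε ^ s) * sobolevNorm k p U (g ε))
    ⟨(hf.aemeasurable_weight p k s).aestronglyMeasurable, hf'⟩
    ⟨(hg.aemeasurable_weight p k s).aestronglyMeasurable, hg'⟩
  have hc : ((ENNReal.LpAddConst p).toNNReal : ℝ≥0∞) = ENNReal.LpAddConst p :=
    ENNReal.coe_toNNReal (ENNReal.LpAddConst_lt_top p).ne
  refine lt_of_le_of_lt (eLpNorm_le_nnreal_smul_eLpNorm_of_ae_le_mul'
    (c := (ENNReal.LpAddConst p).toNNReal) ?_ q) (ENNReal.mul_lt_top ENNReal.coe_lt_top hsum)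
  filter_upwards [ae_dlog_mem] with ε hε
  simp only [enorm_eq_self, Pi.add_apply]
  rw [hc, ← mul_add, mul_left_comm]
  gcongr
  exact sobolevNorm_add_le hf hg p k hε

theorem growthNorm_smul_lt_top {U : Opens (RSp d)} {f : Net d} (c : ℂ) (hf : IsSmoothNet U f)
    {p q : ℝ≥0∞} {k : ℕ} {s : ℝ} (hf' : growthNorm p q k s U f < ⊤) :
    growthNorm p q k s U (c • f) < ⊤ := by
  refine lt_of_le_of_lt (eLpNorm_le_nnreal_smul_eLpNorm_of_ae_le_mul'
    (c := ‖c‖₊) ?_ q) (ENNReal.mul_lt_top ENNReal.coe_lt_top hf')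
  filter_upwards [ae_dlog_mem] with ε hε
  simp only [enorm_eq_self]
  rw [mul_left_comm]
  gcongr
  exact sobolevNorm_smul_le c hf p k hε

theorem growthNorm_zero (p q : ℝ≥0∞) (k : ℕ) (s : ℝ) (U : Set (RSp d)) :
    growthNorm p q k s U (0 : Net d) = 0 := by
  have h (j : ℕ) (m : Fin j → Fin d) : pderiv m (0 : RSp d → ℂ) = 0 := by
    funext x
    simp [pderiv]
  simp [growthNorm, sobolevNorm, h]

theorem growthNorm_anti {p q : ℝ≥0∞} {k : ℕ} {s t : ℝ} (hst : s ≤ t) (U : Set (RSp d))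
    (f : Net d) : growthNorm p q k t U f ≤ growthNorm p q k s U f := by
  refine eLpNorm_mono_enorm_ae ?_
  filter_upwards [ae_dlog_mem] with ε hε
  simp only [enorm_eq_self]
  gcongr ENNReal.ofReal ?_ * _
  exact Real.rpow_le_rpow_of_exponent_ge hε.1 hε.2.le hst

theorem RelCompact.le {U Ω : Opens (RSp d)} (h : RelCompact U Ω) : U ≤ Ω :=
  subset_closure.trans h.2

theorem RelCompact.mono {U Ω Ω' : Opens (RSp d)} (h : RelCompact U Ω) (hΩ : Ω ≤ Ω') :
    RelCompact U Ω' :=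
  ⟨h.1, h.2.trans hΩ⟩

/-! ### The spaces `𝓖_q(Ω)` -/

/-- The space `𝓔_q(Ω)` of nets with `L^q`-moderate growth. -/
def moderateNets (p q : ℝ≥0∞) (Ω : Opens (RSp d)) : Submodule ℂ (Net d) where
  carrier := {f | IsModerate p q Ω f}
  add_mem' := by
    rintro f g ⟨hf, hf'⟩ ⟨hg, hg'⟩
    refine ⟨hf.add hg, fun k U hU => ?_⟩
    obtain ⟨s, hs⟩ := hf' k U hU
    obtain ⟨t, ht⟩ := hg' k U hU
    exact ⟨max s t, growthNorm_add_lt_top (hf.mono hU.le) (hg.mono hU.le)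
      ((growthNorm_anti (le_max_left s t) _ _).trans_lt hs)
      ((growthNorm_anti (le_max_right s t) _ _).trans_lt ht)⟩
  zero_mem' := ⟨IsSmoothNet.zero Ω, fun k U _ => ⟨0, by simp [growthNorm_zero]⟩⟩
  smul_mem' := by
    rintro c f ⟨hf, hf'⟩
    refine ⟨hf.smul c, fun k U hU => ?_⟩
    obtain ⟨s, hs⟩ := hf' k U hU
    exact ⟨s, growthNorm_smul_lt_top c (hf.mono hU.le) hs⟩

/-- The space `𝓝_q(Ω)` of `L^q`-negligible nets. -/
def negligibleNets (p q : ℝ≥0∞) (Ω : Opens (RSp d)) : Submodule ℂ (Net d) where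
  carrier := {f | IsNegligible p q Ω f}
  add_mem' := by
    rintro f g ⟨hf, hf'⟩ ⟨hg, hg'⟩
    exact ⟨hf.add hg, fun k U hU s => growthNorm_add_lt_top (hf.mono hU.le) (hg.mono hU.le)
      (hf' k U hU s) (hg' k U hU s)⟩
  zero_mem' := ⟨IsSmoothNet.zero Ω, fun k U _ s => by simp [growthNorm_zero]⟩
  smul_mem' := by
    rintro c f ⟨hf, hf'⟩
    exact ⟨hf.smul c, fun k U hU s => growthNorm_smul_lt_top c (hf.mono hU.le) (hf' k U hU s)⟩

/-- The space of generalized functions `𝓖_q(Ω) = 𝓔_q(Ω) / 𝓝_q(Ω)`. -/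
abbrev GSpace (p q : ℝ≥0∞) (Ω : Opens (RSp d)) : Type :=
  moderateNets p q Ω ⧸ (negligibleNets p q Ω).comap (moderateNets p q Ω).subtype

/-- The class `[(f_ε)_ε]` in `𝓖_q(Ω)` of a moderate net. -/
def GSpace.mk {p q : ℝ≥0∞} {Ω : Opens (RSp d)} (f : moderateNets p q Ω) : GSpace p q Ω :=
  Submodule.Quotient.mk f

theorem moderateNets_anti (p q : ℝ≥0∞) {U Ω : Opens (RSp d)} (h : U ≤ Ω) :
    moderateNets p q Ω ≤ moderateNets p q U :=
  fun _ hf => ⟨hf.1.mono h, fun k V hV => hf.2 k V (hV.mono h)⟩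

theorem negligibleNets_anti (p q : ℝ≥0∞) {U Ω : Opens (RSp d)} (h : U ≤ Ω) :
    negligibleNets p q Ω ≤ negligibleNets p q U :=
  fun _ hf => ⟨hf.1.mono h, fun k V hV => hf.2 k V (hV.mono h)⟩

/-- The restriction map `u ↦ u|_U` of the sheaf `𝓖_q`. -/
def GSpace.restrict {p q : ℝ≥0∞} {U Ω : Opens (RSp d)} (h : U ≤ Ω) :
    GSpace p q Ω →ₗ[ℂ] GSpace p q U :=
  Submodule.mapQ _ _ (Submodule.inclusion (moderateNets_anti p q h))
    fun _ hf => negligibleNets_anti p q h hf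

/-- The subspace `𝓖^{k,-s}_{q,p}(Ω)`: the generalized functions having a representative `f` in
`𝓔_q(Ω)` with `∫_0^1 ε^{sq} ‖f_ε‖_{W^{k,p}(U)}^q dε/ε < ⊤` for all `U ⋐ Ω`. -/
def GRegular (p q : ℝ≥0∞) (k : ℕ) (s : ℝ) (Ω : Opens (RSp d)) : Set (GSpace p q Ω) :=
  {u | ∃ f : moderateNets p q Ω,
    (∀ U : Opens (RSp d), RelCompact U Ω → growthNorm p q k s U (f : Net d) < ⊤) ∧
      u = GSpace.mk f}

/-- The space `𝓖^∞_q(Ω)` of regular generalized functions. -/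
def GInfty (p q : ℝ≥0∞) (Ω : Opens (RSp d)) : Set (GSpace p q Ω) :=
  {u | ∀ (U : Opens (RSp d)) (hU : RelCompact U Ω), ∃ s : ℝ, ∀ k : ℕ,
    GSpace.restrict hU.le u ∈ GRegular p q k s U}

/-! ### Distributions and their embedding -/

/-- The value `⟨T, ρ⟩` of a distribution on a complex valued test function. -/
noncomputable def pairing {Ω : Opens (RSp d)} (T : 𝓓'(Ω, ℂ)) (ρ : 𝓓(Ω, ℂ)) : ℂ :=
  T (TestFunction.postcompCLM Complex.reCLM ρ) +
    Complex.I * T (TestFunction.postcompCLM Complex.imCLM ρ)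

/-- The regular distribution `ρ ↦ ∫ ρ(x) f(x) dx` defined by a function `f` that is locally
integrable on `Ω`. -/
noncomputable def toDistribution (Ω : Opens (RSp d)) (f : RSp d → ℂ) : 𝓓'(Ω, ℂ) :=
  ContinuousLinearMap.toUniformConvergenceCLM _ _ _
    (TestFunction.integralAgainstBilinCLM (ContinuousLinearMap.lsmul ℝ ℝ) volume f)

/-- `C^∞(Ω)` as a subset of `𝓓'(Ω)`. -/
def smoothDistributions (Ω : Opens (RSp d)) : Set 𝓓'(Ω, ℂ) :=
  {T | ∃ f : RSp d → ℂ, ContDiffOn ℝ ∞ f Ω ∧ T = toDistribution Ω f}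

/-- The integral of a mollifier is one and all its higher moments vanish. -/
structure IsMollifier (φ : 𝓢(RSp d, ℂ)) : Prop where
  integral_eq_one : ∫ x, φ x = 1
  moments : ∀ α : Fin d → ℕ, α ≠ 0 → ∫ x : RSp d, ((∏ i, x i ^ α i : ℝ) : ℂ) * φ x = 0

/-- `φ_ε = ε^{-d} φ(· / ε)`. -/
noncomputable def scaled (φ : 𝓢(RSp d, ℂ)) (ε : ℝ) (x : RSp d) : ℂ :=
  ((ε ^ d)⁻¹ : ℝ) • φ (ε⁻¹ • x)

/-- The test function `y ↦ χ(y) φ_ε(x - y)` on `Ω`. -/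
noncomputable def cutKernel {Ω : Opens (RSp d)} (φ : 𝓢(RSp d, ℂ)) (χ : 𝓓(Ω, ℝ)) (ε : ℝ)
    (x : RSp d) : 𝓓(Ω, ℂ) where
  toFun y := χ y • scaled φ ε (x - y)
  contDiff' := by
    have h1 : ContDiff ℝ ∞ (fun y => φ (ε⁻¹ • (x - y))) :=
      (φ.smooth ⊤).comp ((contDiff_const.sub contDiff_id).const_smul _)
    exact χ.contDiff.smul (h1.const_smul _)
  hasCompactSupport' := χ.hasCompactSupport.smul_right
  tsupport_subset' := (tsupport_smul_subset_left _ _).trans χ.tsupport_subset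

/-- The net `ε ↦ (χ T) ∗ φ_ε` that regularizes the compactly supported distribution `χ T`:
`((χ T) ∗ φ_ε)(x) = ⟨χ T, φ_ε(x - ·)⟩ = ⟨T, χ φ_ε(x - ·)⟩`. -/
noncomputable def mollifiedNet {Ω : Opens (RSp d)} (φ : 𝓢(RSp d, ℂ)) (χ : 𝓓(Ω, ℝ))
    (T : 𝓓'(Ω, ℂ)) : Net d :=
  fun ε x => pairing T (cutKernel φ χ ε x)

/-- The defining property of the sheaf embedding `ι : 𝓓' → 𝓖_q` that extends
`S ↦ [(S ∗ φ_ε)_ε]` from compactly supported distributions: since `T|_U = (χ T)|_U` whenever the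
cut-off `χ ∈ 𝓓(Ω)` is equal to one on `U`, one has `u = ι(T)` precisely when
`u|_U = [((χ T) ∗ φ_ε)_ε]|_U` for all such `U` and `χ`. -/
def IsEmbeddingOf {p q : ℝ≥0∞} {Ω : Opens (RSp d)} (φ : 𝓢(RSp d, ℂ)) (T : 𝓓'(Ω, ℂ))
    (u : GSpace p q Ω) : Prop :=
  ∀ (U : Opens (RSp d)) (hU : U ≤ Ω) (χ : 𝓓(Ω, ℝ)), (∀ x ∈ U, χ x = 1) →
    ∃ h : mollifiedNet φ χ T ∈ moderateNets p q U,
      GSpace.restrict hU u = GSpace.mk ⟨mollifiedNet φ χ T, h⟩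

/-- The embedding `ι : 𝓓'(Ω) → 𝓖_q(Ω)`: `ι(T)` is the element with the property
`IsEmbeddingOf φ T`. -/
noncomputable def iota (p q : ℝ≥0∞) {Ω : Opens (RSp d)} (φ : 𝓢(RSp d, ℂ)) (T : 𝓓'(Ω, ℂ)) :
    GSpace p q Ω :=
  Classical.epsilon (IsEmbeddingOf φ T)

end LqColombeau

/-!
A localized distribution `χ T` extends to a functional `localized T χ` on Schwartz functions. It has
finite order, so it is bounded in a Sobolev norm, and the Riesz representation theorem gives it a
symbol: a measurable `H` of polynomial growth (in the integrated sense `IsSymbol`) with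
`⟨χ T, ψ⟩ = ∫ H 𝓕ψ` (`exists_symbol`). Consequently
`(χ T) ∗ φ_ε = 𝓕 (ξ ↦ H(ξ) 𝓕φ(-ε ξ))` (`mollifiedNet_eq_symbolNet`), and the growth of this net
can be read off from `H`: it is always moderate (`mollifiedNet_mem_moderateNets`), it is bounded with
all derivatives if `T` is smooth, since `H` is then a Schwartz function
(`growthNorm_mollifiedNet_lt_top`), and by the finite order of `χ T` and the decay of `φ` it is
negligible wherever `χ` vanishes (`mollifiedNet_mem_negligibleNets`).

The last fact makes the local nets for different cut-off functions `χ` equivalent where these agree.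
Along an exhaustion of `Ω` they are patched to one global net by negligible corrections
(`exists_isEmbeddingOf`), and negligibility is local, which gives uniqueness
(`IsEmbeddingOf.unique`).

Regularity is a Fourier argument. Let `θ` be a second cut-off function and
`W(η) = ∫ H(ξ) 𝓕θ(ξ + η) dξ` the Fourier transform of `θ χ T`. Let `W_ε` be the Fourier transform of
`θ ((χ T) ∗ φ_ε)`. Since `𝓕φ(0) = 1`, one has `|W - W_ε| ≤ C ε (1 + |η|)^N`
(`norm_windowed_sub_le`), and `|W_ε(η)|` is bounded by `(1 + |η|)^{-k}` times a Sobolev norm of order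
`k` of the net (`fourier_cutoff_smul_le`). If all these Sobolev norms grow at most like `ε^{-s}` with
`s` independent of `k`, then choosing `ε` of the size `(1 + |η|)^{-a}` with `a` large, and afterwards
`k` large, shows that `W` decreases rapidly (`windowed_rapid_decay`). As the growth condition is an
`L^q` condition, the pointwise bound holds only at some `ε` in each dyadic interval, which is enough
(`exists_le_of_eLpNorm_dlog_lt_top`). Thus `T` is given by a smooth function where `χ = θ = 1`
(`exists_contDiff_of_growthNorm`), and these functions glue.
-/

namespace LqColombeau

variable {d : ℕ}

/-! ### Localized distributions as functionals on Schwartz functions -/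

section Localized

variable {Ω : Opens (RSp d)}

/-- The test function `χ ψ` obtained by cutting off a Schwartz function `ψ`. -/
noncomputable def cutoffMul (χ : 𝓓(Ω, ℝ)) (ψ : 𝓢(RSp d, ℂ)) : 𝓓(Ω, ℂ) where
  toFun y := χ y • ψ y
  contDiff' := χ.contDiff.smul (ψ.smooth ⊤)
  hasCompactSupport' := χ.hasCompactSupport.smul_right
  tsupport_subset' := (tsupport_smul_subset_left _ _).trans χ.tsupport_subset

theorem pairing_add (T : 𝓓'(Ω, ℂ)) (ρ σ : 𝓓(Ω, ℂ)) :
    pairing T (ρ + σ) = pairing T ρ + pairing T σ := by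
  simp only [pairing, map_add]; ring

theorem pairing_smul (T : 𝓓'(Ω, ℂ)) (c : ℂ) (ρ : 𝓓(Ω, ℂ)) :
    pairing T (c • ρ) = c * pairing T ρ := by
  have h1 : TestFunction.postcompCLM Complex.reCLM (c • ρ) =
      c.re • TestFunction.postcompCLM Complex.reCLM ρ -
        c.im • TestFunction.postcompCLM Complex.imCLM ρ := by
    ext x; simp [TestFunction.postcompCLM_apply]
  have h2 : TestFunction.postcompCLM Complex.imCLM (c • ρ) =
      c.re • TestFunction.postcompCLM Complex.imCLM ρ +
        c.im • TestFunction.postcompCLM Complex.reCLM ρ := by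
    ext x; simp [TestFunction.postcompCLM_apply]
  simp only [pairing, h1, h2, map_add, map_sub, map_smul, Complex.real_smul]
  conv_rhs => rw [← Complex.re_add_im c]
  linear_combination (-(c.im : ℂ) * T (TestFunction.postcompCLM Complex.imCLM ρ)) * Complex.I_sq

/-- The functional `χ T`, tested against Schwartz functions. -/
noncomputable def localized (T : 𝓓'(Ω, ℂ)) (χ : 𝓓(Ω, ℝ)) : 𝓢(RSp d, ℂ) →ₗ[ℂ] ℂ where
  toFun ψ := pairing T (cutoffMul χ ψ)
  map_add' ψ₁ ψ₂ := by
    rw [← pairing_add]; congr 1; ext x; simp [cutoffMul]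
  map_smul' c ψ := by
    rw [RingHom.id_apply, smul_eq_mul, ← pairing_smul]; congr 1; ext x
    simp [cutoffMul, mul_left_comm]

/-- A distribution has finite order on every compact set. -/
theorem exists_order_bound (T : 𝓓'(Ω, ℂ)) (K : Compacts (RSp d)) (hK : (K : Set (RSp d)) ⊆ Ω) :
    ∃ (N : ℕ) (C : ℝ), 0 ≤ C ∧ ∀ (ρ : ContDiffMapSupportedIn (RSp d) ℝ ⊤ K) (M : ℝ), 0 ≤ M →
      (∀ j ≤ N, ∀ y ∈ K, ‖iteratedFDeriv ℝ j ρ y‖ ≤ M) →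
      ‖T (TestFunction.ofSupportedIn hK ρ)‖ ≤ C * M := by
  let A : ContDiffMapSupportedIn (RSp d) ℝ ⊤ K →ₗ[ℝ] ℂ :=
    { toFun := fun ρ => T (TestFunction.ofSupportedIn hK ρ)
      map_add' := fun a b =>
        map_add T (TestFunction.ofSupportedIn hK a) (TestFunction.ofSupportedIn hK b)
      map_smul' := fun a b => map_smul T a (TestFunction.ofSupportedIn hK b) }
  have hA : Continuous A :=
    (ContinuousLinearMap.continuous T).comp (TestFunction.continuous_ofSupportedIn hK)
  have hq : Continuous ((normSeminorm ℝ ℂ).comp A) := continuous_norm.comp hA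
  obtain ⟨s, C, -, hC⟩ := Seminorm.bound_of_continuous
    (ContDiffMapSupportedIn.withSeminorms ℝ (RSp d) ℝ ⊤ K) _ hq
  refine ⟨s.sup id, C, C.2, fun ρ M hM h => ?_⟩
  refine (hC ρ).trans ?_
  rw [smul_apply, NNReal.smul_def, smul_eq_mul]
  refine mul_le_mul_of_nonneg_left ?_ C.2
  refine Seminorm.finset_sup_apply_le hM fun i hi => ?_
  rw [ContDiffMapSupportedIn.seminorm_top_le_iff ℝ hM]
  exact h i (Finset.le_sup (f := id) hi)

/-- The functional `χ T` is bounded by finitely many derivatives on the support of `χ`. -/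
theorem localized_bound (T : 𝓓'(Ω, ℂ)) (χ : 𝓓(Ω, ℝ)) :
    ∃ (N : ℕ) (C : ℝ), 0 ≤ C ∧ ∀ (ψ : 𝓢(RSp d, ℂ)) (M : ℝ), 0 ≤ M →
      (∀ j ≤ N, ∀ y ∈ tsupport χ, ‖iteratedFDeriv ℝ j ψ y‖ ≤ M) → ‖localized T χ ψ‖ ≤ C * M := by
  let K : Compacts (RSp d) := ⟨tsupport χ, χ.hasCompactSupport⟩
  obtain ⟨N, C, hC, h⟩ := exists_order_bound T K χ.tsupport_subset
  have hA : ∀ i : ℕ, ∃ A, ∀ y, ‖iteratedFDeriv ℝ i χ y‖ ≤ A := fun i =>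
    (χ.contDiff.continuous_iteratedFDeriv (by exact_mod_cast le_top)).bounded_above_of_compact_support
      (χ.hasCompactSupport.iteratedFDeriv i)
  choose A hA using hA
  have hA0 : ∀ i, 0 ≤ A i := fun i => (norm_nonneg _).trans (hA i 0)
  set B : ℝ := ∑ j ∈ Finset.range (N + 1), ∑ i ∈ Finset.range (j + 1), (j.choose i : ℝ) * A i
    with hB
  have hB0 : 0 ≤ B := Finset.sum_nonneg fun j _ => Finset.sum_nonneg fun i _ =>
    mul_nonneg (Nat.cast_nonneg _) (hA0 i)
  refine ⟨N, C * B + C * B, by positivity, fun ψ M hM hψ => ?_⟩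
  have key : ∀ j ≤ N, ∀ y ∈ K, ‖iteratedFDeriv ℝ j (cutoffMul χ ψ) y‖ ≤ B * M := by
    intro j hj y hy
    refine (norm_iteratedFDeriv_smul_le (N := ∞) χ.contDiff (ψ.smooth ⊤) y
      (by exact_mod_cast le_top)).trans ?_
    have h1 : ∑ i ∈ Finset.range (j + 1), (j.choose i : ℝ) * ‖iteratedFDeriv ℝ i χ y‖ *
        ‖iteratedFDeriv ℝ (j - i) ψ y‖ ≤
        (∑ i ∈ Finset.range (j + 1), (j.choose i : ℝ) * A i) * M := by
      rw [Finset.sum_mul]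
      refine Finset.sum_le_sum fun i _ => ?_
      exact mul_le_mul (mul_le_mul_of_nonneg_left (hA i y) (Nat.cast_nonneg _))
        (hψ _ ((Nat.sub_le _ _).trans hj) y hy) (norm_nonneg _)
        (mul_nonneg (Nat.cast_nonneg _) (hA0 i))
    refine h1.trans (mul_le_mul_of_nonneg_right ?_ hM)
    exact Finset.single_le_sum (f := fun j => ∑ i ∈ Finset.range (j + 1), (j.choose i : ℝ) * A i)
      (fun j _ => Finset.sum_nonneg fun i _ => mul_nonneg (Nat.cast_nonneg _) (hA0 i))
      (Finset.mem_range.2 (Nat.lt_succ_of_le hj))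
  -- the pairing is assembled from the real and the imaginary part of the test function
  have part : ∀ L : ℂ →L[ℝ] ℝ, ‖L‖ = 1 →
      ‖T (TestFunction.postcompCLM L (cutoffMul χ ψ))‖ ≤ C * (B * M) := by
    intro L hL
    let ρ : ContDiffMapSupportedIn (RSp d) ℝ ⊤ K :=
      ContDiffMapSupportedIn.of_support_subset
        (TestFunction.postcompCLM L (cutoffMul χ ψ)).contDiff (by
          intro x hx
          refine subset_tsupport _ fun h0 => hx ?_
          change L (χ x • ψ x) = 0
          rw [h0, zero_smul, map_zero])
    refine h ρ (B * M) (by positivity) fun j hj y hy => ?_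
    refine le_trans ?_ (key j hj y hy)
    change ‖iteratedFDeriv ℝ j (L ∘ cutoffMul χ ψ) y‖ ≤ _
    refine (L.norm_iteratedFDeriv_comp_left (cutoffMul χ ψ).contDiff.contDiffAt
      (by exact_mod_cast le_top)).trans ?_
    rw [hL, one_mul]
  change ‖T (TestFunction.postcompCLM Complex.reCLM (cutoffMul χ ψ)) +
    Complex.I * T (TestFunction.postcompCLM Complex.imCLM (cutoffMul χ ψ))‖ ≤ _
  refine (norm_add_le _ _).trans ?_
  rw [norm_mul, Complex.norm_I, one_mul, add_mul]
  refine add_le_add ?_ ?_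
  · exact (part _ Complex.reCLM_norm).trans_eq (by ring)
  · exact (part _ Complex.imCLM_norm).trans_eq (by ring)

end Localized

/-! ### The Fourier symbol of a localized distribution -/

section Symbol

open scoped FourierTransform ComplexConjugate

/-- The function `H` has polynomial growth of order `P`, in the sense that it is integrable against
the weight `(1 + ‖ξ‖)^{-P}`. -/
def IsSymbol (P : ℕ) (H : RSp d → ℂ) : Prop :=
  Integrable fun ξ => (((1 + ‖ξ‖) ^ P)⁻¹ : ℝ) • H ξ

theorem norm_iteratedFDeriv_fourier_le_integral {f : RSp d → ℂ}
    (hf : ∀ n : ℕ, Integrable fun v => ‖v‖ ^ n * ‖f v‖) (hm : AEStronglyMeasurable f volume)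
    (j : ℕ) (x : RSp d) :
    ‖iteratedFDeriv ℝ j (𝓕 f) x‖ ≤ (2 * Real.pi) ^ j * ∫ v, ‖v‖ ^ j * ‖f v‖ := by
  rw [Real.iteratedFDeriv_fourier (N := ⊤) (fun n _ => hf n) hm le_top]
  refine (VectorFourier.norm_fourierIntegral_le_integral_norm _ _ _ _ _).trans ?_
  rw [← integral_const_mul]
  refine integral_mono_of_nonneg (ae_of_all _ fun v => norm_nonneg _)
    ((hf j).const_mul _) (ae_of_all _ fun v => ?_)
  refine (VectorFourier.norm_fourierPowSMulRight_le _ f v j).trans ?_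
  simp only
  rw [← mul_assoc]
  gcongr ?_ * _ * _
  refine pow_le_pow_left₀ (by positivity) ?_ j
  exact mul_le_of_le_one_right (by positivity) (norm_innerSL_le ℝ)

/-- Multiplication of Schwartz functions by `(1 + ‖ξ‖²)^r`. -/
noncomputable def besselMul (r : ℝ) : 𝓢(RSp d, ℂ) →L[ℂ] 𝓢(RSp d, ℂ) :=
  SchwartzMap.smulLeftCLM ℂ fun ξ : RSp d => (((1 + ‖ξ‖ ^ 2) ^ r : ℝ) : ℂ)

theorem besselMul_apply (r : ℝ) (g : 𝓢(RSp d, ℂ)) (ξ : RSp d) :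
    besselMul r g ξ = (((1 + ‖ξ‖ ^ 2) ^ r : ℝ) : ℂ) * g ξ := by
  rw [besselMul, SchwartzMap.smulLeftCLM_apply_apply (by fun_prop), smul_eq_mul]

theorem one_add_sq_pos (ξ : RSp d) : 0 < 1 + ‖ξ‖ ^ 2 := by positivity

theorem besselMul_neg_besselMul (r : ℝ) (g : 𝓢(RSp d, ℂ)) :
    besselMul (-r) (besselMul r g) = g := by
  ext ξ
  rw [besselMul_apply, besselMul_apply, ← mul_assoc, ← Complex.ofReal_mul,
    ← Real.rpow_add (one_add_sq_pos ξ)]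
  simp

theorem memLp_two_bessel : MemLp (fun ξ : RSp d => (1 + ‖ξ‖ ^ 2) ^ (-(d + 1 : ℝ))) 2 volume := by
  have hc : Continuous fun ξ : RSp d => (1 + ‖ξ‖ ^ 2) ^ (-(d + 1 : ℝ)) :=
    Continuous.rpow_const (by fun_prop) fun ξ => Or.inl (one_add_sq_pos ξ).ne'
  rw [memLp_two_iff_integrable_sq_norm hc.aestronglyMeasurable]
  have h := integrable_rpow_neg_one_add_norm_sq (E := RSp d) (μ := volume) (r := 4 * (d + 1 : ℝ))
    (by simp only [finrank_euclideanSpace, Fintype.card_fin]; linarith [Nat.cast_nonneg (α := ℝ) d])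
  refine h.congr (ae_of_all _ fun ξ => ?_)
  simp only [Real.norm_eq_abs, sq_abs]
  rw [← Real.rpow_mul_natCast (one_add_sq_pos ξ).le]
  congr 1; push_cast; ring

/-- The Sobolev embedding `H^s ⊂ C^N` on the Fourier side. -/
theorem iteratedFDeriv_fourierInv_besselMul_le (N : ℕ) :
    ∃ C, 0 ≤ C ∧ ∀ (g : 𝓢(RSp d, ℂ)), ∀ j ≤ N, ∀ x,
      ‖iteratedFDeriv ℝ j (𝓕⁻ (besselMul (-(N + (d + 1) : ℝ)) g) : 𝓢(RSp d, ℂ)) x‖ ≤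
        C * ‖g.toLp 2 volume‖ := by
  set w : RSp d → ℝ := fun ξ => (1 + ‖ξ‖ ^ 2) ^ (-(d + 1 : ℝ)) with hw
  refine ⟨(2 * Real.pi) ^ N * (∫ ξ, ‖w ξ‖ ^ (2 : ℝ)) ^ (1 / 2 : ℝ), by positivity,
    fun g j hj x => ?_⟩
  set h := besselMul (-(N + (d + 1) : ℝ)) g with hh
  have e1 : ((𝓕⁻ h : 𝓢(RSp d, ℂ)) : RSp d → ℂ) = 𝓕 (fun ξ => h (-ξ)) := by
    rw [SchwartzMap.fourierInv_coe, Real.fourierInv_eq_fourier_comp_neg]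
  have hi : ∀ n : ℕ, Integrable fun ξ : RSp d => ‖ξ‖ ^ n * ‖h ξ‖ :=
    fun n => h.integrable_pow_mul volume n
  rw [e1]
  refine (norm_iteratedFDeriv_fourier_le_integral (fun n => ?_)
    (h.continuous.comp continuous_neg).aestronglyMeasurable j x).trans ?_
  · simpa using (hi n).comp_neg
  have e2 : ∫ v : RSp d, ‖v‖ ^ j * ‖h (-v)‖ = ∫ v, ‖v‖ ^ j * ‖h v‖ := by
    rw [← integral_neg_eq_self (fun v : RSp d => ‖v‖ ^ j * ‖h v‖)]
    simp
  simp only [Function.comp_apply]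
  rw [e2]
  have hwg : Integrable fun v : RSp d => ‖w v‖ * ‖g v‖ := by
    have := (memLp_two_bessel (d := d)).norm.integrable_mul (g.memLp 2 volume).norm
    exact this
  have e3 : ∫ v : RSp d, ‖v‖ ^ j * ‖h v‖ ≤ ∫ v, ‖w v‖ * ‖g v‖ := by
    refine integral_mono (hi j) hwg fun v => ?_
    have h1 : (1 : ℝ) ≤ 1 + ‖v‖ ^ 2 := by nlinarith [sq_nonneg ‖v‖]
    have h2 : ‖v‖ ^ j ≤ (1 + ‖v‖ ^ 2) ^ (N : ℝ) := by
      rw [Real.rpow_natCast]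
      refine le_trans ?_ (pow_le_pow_right₀ h1 hj)
      gcongr
      nlinarith [sq_nonneg (‖v‖ - 1)]
    have h3 : ‖h v‖ = (1 + ‖v‖ ^ 2) ^ (-(N : ℝ)) * (w v * ‖g v‖) := by
      rw [hh, besselMul_apply, norm_mul, Complex.norm_real, Real.norm_of_nonneg (by positivity),
        ← mul_assoc, hw, ← Real.rpow_add (one_add_sq_pos v)]
      congr 2; ring
    have h4 : 0 ≤ w v := by positivity
    simp only [h3, Real.norm_of_nonneg h4]
    rw [← mul_assoc, Real.rpow_neg (one_add_sq_pos v).le]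
    refine mul_le_of_le_one_left (by positivity) ?_
    rw [← div_eq_mul_inv]
    exact div_le_one_of_le₀ h2 (by positivity)
  have e4 := integral_mul_norm_le_Lp_mul_Lq (μ := (volume : Measure (RSp d)))
    (f := fun v => (w v : ℂ)) (g := g) Real.HolderConjugate.two_two
    (by rw [ENNReal.ofReal_ofNat]; exact (memLp_two_bessel (d := d)).ofReal (K := ℂ))
    (by simpa using g.memLp 2 volume)
  have e5 : ‖g.toLp 2 volume‖ = (∫ a, ‖g a‖ ^ (2 : ℝ)) ^ (1 / 2 : ℝ) := by
    rw [SchwartzMap.norm_toLp' two_ne_zero ENNReal.ofNat_ne_top]; simp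
  simp only [Complex.norm_real] at e4
  rw [e5, mul_assoc]
  refine mul_le_mul ?_ (e3.trans e4) (integral_nonneg fun v => by positivity) (by positivity)
  exact pow_le_pow_right₀ (by linarith [Real.pi_gt_three]) hj

variable {Ω : Opens (RSp d)}

/-- A localized distribution acts on Schwartz functions by integrating their Fourier transform
against a function of polynomial growth: it is bounded for some Sobolev norm, so that the Riesz
representation theorem applies. -/
theorem exists_symbol (T : 𝓓'(Ω, ℂ)) (χ : 𝓓(Ω, ℝ)) :
    ∃ (P : ℕ) (H : RSp d → ℂ), IsSymbol P H ∧
      ∀ ψ : 𝓢(RSp d, ℂ), localized T χ ψ = ∫ ξ, H ξ * (𝓕 ψ : 𝓢(RSp d, ℂ)) ξ := by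
  obtain ⟨N, C, hC, hb⟩ := localized_bound T χ
  obtain ⟨C', hC', hs⟩ := iteratedFDeriv_fourierInv_besselMul_le (d := d) N
  set r : ℝ := N + (d + 1) with hr
  let w : 𝓢(RSp d, ℂ) →ₗ[ℂ] ℂ := (localized T χ) ∘ₗ
    ((FourierTransform.fourierCLE ℂ 𝓢(RSp d, ℂ)).symm.toLinearEquiv.toLinearMap) ∘ₗ
      (besselMul (-r)).toLinearMap
  have hw : ∀ g, w g = localized T χ (𝓕⁻ (besselMul (-r) g) : 𝓢(RSp d, ℂ)) := fun g => rfl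
  let e : 𝓢(RSp d, ℂ) →ₗ[ℂ] Lp ℂ 2 (volume : Measure (RSp d)) :=
    (SchwartzMap.toLpCLM ℂ ℂ 2 volume).toLinearMap
  have he : ∀ g, e g = g.toLp 2 volume := fun g => rfl
  have hd : DenseRange e := SchwartzMap.denseRange_toLpCLM (E := RSp d) (F := ℂ) (p := 2)
    ENNReal.ofNat_ne_top (μ := volume)
  -- the finite order of `χ T` and the Sobolev embedding
  have hbd : ∃ K, ∀ g, ‖w g‖ ≤ K * ‖e g‖ := by
    refine ⟨C * C', fun g => ?_⟩
    rw [hw, he, mul_assoc]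
    exact hb _ _ (by positivity) fun j hj y _ => hs g j hj y
  let ℓ := w.extendOfNorm e
  have hℓ : ∀ g, ℓ (e g) = w g := LinearMap.extendOfNorm_eq hd hbd
  let h := (InnerProductSpace.toDual ℂ (Lp ℂ 2 (volume : Measure (RSp d)))).symm ℓ
  have hrep : ∀ g : 𝓢(RSp d, ℂ), w g = ∫ ξ, conj (h ξ) * g ξ := by
    intro g
    rw [← hℓ, ← InnerProductSpace.toDual_symm_apply, L2.inner_def]
    refine integral_congr_ae ?_
    filter_upwards [SchwartzMap.coeFn_toLp g 2 (volume : Measure (RSp d))] with ξ hξ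
    rw [he, hξ, RCLike.inner_apply, mul_comm]
  -- `H` is an `L²` function times `(1 + ‖ξ‖²) ^ r`; the rest of the weight makes `L²` integrable
  refine ⟨4 * (N + (d + 1)), fun ξ => (((1 + ‖ξ‖ ^ 2) ^ r : ℝ) : ℂ) * conj (h ξ), ?_, fun ψ => ?_⟩
  · have h1 : MemLp (fun ξ => conj (h ξ)) 2 (volume : Measure (RSp d)) :=
      (Lp.memLp h).star
    have h2 : Integrable (fun ξ : RSp d => conj (h ξ) *
        (((1 + ‖ξ‖ ^ 2) ^ (-(d + 1 : ℝ)) : ℝ) : ℂ)) volume :=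
      h1.integrable_mul ((memLp_two_bessel (d := d)).ofReal (K := ℂ))
    refine h2.mono ?_ (ae_of_all _ fun ξ => ?_)
    · have c1 : Continuous fun ξ : RSp d => ((1 + ‖ξ‖) ^ (4 * (N + (d + 1))))⁻¹ :=
        Continuous.inv₀ (by fun_prop) fun ξ => by positivity
      have c2 : Continuous fun ξ : RSp d => (((1 + ‖ξ‖ ^ 2) ^ r : ℝ) : ℂ) :=
        Complex.continuous_ofReal.comp
          (Continuous.rpow_const (by fun_prop) fun ξ => Or.inl (one_add_sq_pos ξ).ne')
      exact c1.aestronglyMeasurable.smul (c2.aestronglyMeasurable.mul h1.aestronglyMeasurable)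
    · simp only [norm_smul, norm_mul, Complex.norm_real]
      rw [mul_comm ‖conj (h ξ)‖, ← mul_assoc]
      refine mul_le_mul_of_nonneg_right ?_ (norm_nonneg _)
      rw [Real.norm_of_nonneg (by positivity), Real.norm_of_nonneg (by positivity),
        Real.norm_of_nonneg (by positivity)]
      have h3 : (1 + ‖ξ‖ ^ 2) ^ (-(d + 1 : ℝ)) =
          ((1 + ‖ξ‖ ^ 2) ^ (2 * r))⁻¹ * (1 + ‖ξ‖ ^ 2) ^ (2 * N + (d + 1) : ℝ) := by
        rw [← Real.rpow_neg (one_add_sq_pos ξ).le, ← Real.rpow_add (one_add_sq_pos ξ)]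
        congr 1; rw [hr]; ring
      have h4 : (1 + ‖ξ‖ ^ 2) ^ (2 * r) ≤ (1 + ‖ξ‖) ^ (4 * (N + (d + 1))) := by
        have : 2 * r = ((2 * (N + (d + 1)) : ℕ) : ℝ) := by rw [hr]; push_cast; ring
        rw [this, Real.rpow_natCast, show 4 * (N + (d + 1)) = 2 * (2 * (N + (d + 1))) by ring,
          pow_mul (1 + ‖ξ‖)]
        gcongr
        nlinarith [norm_nonneg ξ]
      rw [h3]
      gcongr
      · nlinarith [sq_nonneg ‖ξ‖]
      · rw [hr]; linarith [Nat.cast_nonneg (α := ℝ) N]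
  · have h1 : ψ = (𝓕⁻ (besselMul (-r) (besselMul r (𝓕 ψ))) : 𝓢(RSp d, ℂ)) := by
      rw [besselMul_neg_besselMul, FourierTransform.fourierInv_fourier_eq]
    conv_lhs => rw [h1, ← hw, hrep]
    refine integral_congr_ae (ae_of_all _ fun ξ => ?_)
    simp only [besselMul_apply]
    ring

end Symbol

/-! ### Mollified nets on the Fourier side -/

section SymbolNet

open scoped FourierTransform LineDeriv

theorem schwartz_decay (g : 𝓢(RSp d, ℂ)) (j P : ℕ) :
    ∃ C, 0 ≤ C ∧ ∀ x, ‖iteratedFDeriv ℝ j g x‖ ≤ C * ((1 + ‖x‖) ^ P)⁻¹ := by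
  refine ⟨2 ^ P * ((Finset.Iic (P, j)).sup fun m => SchwartzMap.seminorm ℝ m.1 m.2) g,
    by positivity, fun x => ?_⟩
  have h := SchwartzMap.one_add_le_sup_seminorm_apply (𝕜 := ℝ) (m := (P, j)) (k := P) (n := j)
    le_rfl le_rfl g x
  rw [← div_eq_mul_inv, le_div_iff₀ (by positivity), mul_comm]
  exact h

theorem schwartz_decay_zero (g : 𝓢(RSp d, ℂ)) (P : ℕ) :
    ∃ C, 0 ≤ C ∧ ∀ x, ‖g x‖ ≤ C * ((1 + ‖x‖) ^ P)⁻¹ := by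
  obtain ⟨C, hC, h⟩ := schwartz_decay g 0 P
  exact ⟨C, hC, fun x => by simpa using h x⟩

/-- The Schwartz function `y ↦ φ_ε(x - y)`. -/
noncomputable def mollifierAt (φ : 𝓢(RSp d, ℂ)) (ε : ℝ) (hε : ε ≠ 0) (x : RSp d) :
    𝓢(RSp d, ℂ) :=
  ((ε ^ d)⁻¹ : ℝ) • SchwartzMap.compSubConstCLM ℝ x (SchwartzMap.compCLMOfContinuousLinearEquiv ℝ
    (ContinuousLinearEquiv.smulLeft (R₁ := ℝ) (M₁ := RSp d)
      (Units.mk0 (-ε⁻¹) (neg_ne_zero.2 (inv_ne_zero hε)))) φ)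

theorem mollifierAt_apply (φ : 𝓢(RSp d, ℂ)) {ε : ℝ} (hε : ε ≠ 0) (x y : RSp d) :
    mollifierAt φ ε hε x y = scaled φ ε (x - y) := by
  change ((ε ^ d)⁻¹ : ℝ) • φ ((-ε⁻¹) • (y - x)) = _
  rw [scaled, neg_smul, ← smul_neg, neg_sub]

theorem fourier_mollifierAt (φ : 𝓢(RSp d, ℂ)) {ε : ℝ} (hε : 0 < ε) (x ξ : RSp d) :
    (𝓕 (mollifierAt φ ε hε.ne' x) : 𝓢(RSp d, ℂ)) ξ =
      Real.fourierChar (-inner ℝ x ξ) • (𝓕 φ : 𝓢(RSp d, ℂ)) (-(ε • ξ)) := by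
  rw [SchwartzMap.fourier_coe, SchwartzMap.fourier_coe, Real.fourier_eq, Real.fourier_eq]
  simp only [mollifierAt_apply]
  have h1 : ∀ y, Real.fourierChar (-inner ℝ y ξ) • scaled φ ε (x - y) =
      (fun z => Real.fourierChar (-inner ℝ (x - z) ξ) • scaled φ ε z) (x - y) := fun y => by simp
  simp_rw [h1]
  rw [integral_sub_left_eq_self
    (fun z => Real.fourierChar (-inner ℝ (x - z) ξ) • scaled φ ε z) volume x]
  have h2 : ∀ z, Real.fourierChar (-inner ℝ (x - z) ξ) • scaled φ ε z =
      ((ε ^ d)⁻¹ : ℝ) • (fun u => Real.fourierChar (-inner ℝ (x - ε • u) ξ) • φ u) (ε⁻¹ • z) := by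
    intro z
    simp only [scaled, smul_inv_smul₀ hε.ne']
    rw [smul_comm]
  simp_rw [h2]
  rw [integral_smul, Measure.integral_comp_inv_smul volume
    (fun u => Real.fourierChar (-inner ℝ (x - ε • u) ξ) • φ u) ε,
    finrank_euclideanSpace, Fintype.card_fin,
    abs_of_pos (by positivity), inv_smul_smul₀ (by positivity), Circle.smul_def, ← integral_smul]
  refine integral_congr_ae (ae_of_all _ fun u => ?_)
  simp only
  rw [← Circle.smul_def, smul_smul, ← AddChar.map_add_eq_mul]
  congr 2
  rw [inner_sub_left, inner_neg_right, inner_smul_left, inner_smul_right]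
  simp
  ring

/-- The net `ε ↦ 𝓕 (H 𝓕φ(-ε ·))`, formally the convolution of `𝓕 H` with `φ_ε`. -/
noncomputable def symbolNet (φ : 𝓢(RSp d, ℂ)) (H : RSp d → ℂ) : Net d :=
  fun ε => 𝓕 fun ξ => H ξ * (𝓕 φ : 𝓢(RSp d, ℂ)) (-(ε • ξ))

variable {Ω : Opens (RSp d)}

theorem mollifiedNet_eq_localized (φ : 𝓢(RSp d, ℂ)) (χ : 𝓓(Ω, ℝ)) (T : 𝓓'(Ω, ℂ)) {ε : ℝ}
    (hε : ε ≠ 0) (x : RSp d) :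
    mollifiedNet φ χ T ε x = localized T χ (mollifierAt φ ε hε x) := by
  change pairing T _ = pairing T _
  congr 1
  ext y
  change χ y • scaled φ ε (x - y) = χ y • mollifierAt φ ε hε x y
  rw [mollifierAt_apply]

theorem mollifiedNet_eq_symbolNet (φ : 𝓢(RSp d, ℂ)) {χ : 𝓓(Ω, ℝ)} {T : 𝓓'(Ω, ℂ)}
    {H : RSp d → ℂ}
    (hH : ∀ ψ : 𝓢(RSp d, ℂ), localized T χ ψ = ∫ ξ, H ξ * (𝓕 ψ : 𝓢(RSp d, ℂ)) ξ)
    {ε : ℝ} (hε : 0 < ε) : mollifiedNet φ χ T ε = symbolNet φ H ε := by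
  ext x
  rw [mollifiedNet_eq_localized φ χ T hε.ne', hH, symbolNet, Real.fourier_eq]
  refine integral_congr_ae (ae_of_all _ fun ξ => ?_)
  simp only
  rw [fourier_mollifierAt φ hε, real_inner_comm, mul_smul_comm]

theorem IsSymbol.aestronglyMeasurable {P : ℕ} {H : RSp d → ℂ} (hH : IsSymbol P H) :
    AEStronglyMeasurable H volume := by
  have h : AEStronglyMeasurable (fun ξ : RSp d => (1 + ‖ξ‖) ^ P • ((((1 + ‖ξ‖) ^ P)⁻¹ : ℝ) • H ξ))
      volume :=
    (Continuous.aestronglyMeasurable (f := fun ξ : RSp d => (1 + ‖ξ‖) ^ P) (by fun_prop)).smul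
      (Integrable.aestronglyMeasurable hH)
  refine h.congr (ae_of_all _ fun ξ => ?_)
  simp only
  rw [smul_inv_smul₀ (by positivity)]

theorem IsSymbol.integrable_weight {P : ℕ} {H : RSp d → ℂ} (hH : IsSymbol P H) :
    Integrable fun ξ => ((1 + ‖ξ‖) ^ P)⁻¹ * ‖H ξ‖ := by
  refine hH.norm.congr (ae_of_all _ fun ξ => ?_)
  simp only
  rw [norm_smul, Real.norm_of_nonneg (by positivity)]

theorem aestronglyMeasurable_symbol_mul (φ : 𝓢(RSp d, ℂ)) {H : RSp d → ℂ}
    (hH : AEStronglyMeasurable H volume) (ε : ℝ) :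
    AEStronglyMeasurable (fun ξ => H ξ * (𝓕 φ : 𝓢(RSp d, ℂ)) (-(ε • ξ))) volume :=
  hH.mul (Continuous.aestronglyMeasurable (by fun_prop))

theorem norm_symbol_mul_le (φ : 𝓢(RSp d, ℂ)) (P n : ℕ) :
    ∃ C, 0 ≤ C ∧ ∀ (H : RSp d → ℂ), ∀ ε ∈ Ioo (0 : ℝ) 1, ∀ ξ,
      ‖ξ‖ ^ n * ‖H ξ * (𝓕 φ : 𝓢(RSp d, ℂ)) (-(ε • ξ))‖ ≤
        C * (ε ^ (P + n))⁻¹ * (((1 + ‖ξ‖) ^ P)⁻¹ * ‖H ξ‖) := by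
  obtain ⟨C, hC, h⟩ := schwartz_decay_zero (𝓕 φ : 𝓢(RSp d, ℂ)) (P + n)
  refine ⟨C, hC, fun H ε hε ξ => ?_⟩
  have h0 : ε * (1 + ‖ξ‖) ≤ 1 + ‖-(ε • ξ)‖ := by
    rw [norm_neg, norm_smul, Real.norm_of_nonneg hε.1.le, mul_add, mul_one]
    linarith [hε.2]
  have h1 : ((1 + ‖-(ε • ξ)‖) ^ (P + n))⁻¹ ≤ ((ε * (1 + ‖ξ‖)) ^ (P + n))⁻¹ := by
    have := hε.1
    gcongr
  have h2 : ‖ξ‖ ^ n ≤ (1 + ‖ξ‖) ^ n := by gcongr; linarith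
  have hp := hε.1
  calc ‖ξ‖ ^ n * ‖H ξ * (𝓕 φ : 𝓢(RSp d, ℂ)) (-(ε • ξ))‖
      ≤ (1 + ‖ξ‖) ^ n * (‖H ξ‖ * (C * ((ε * (1 + ‖ξ‖)) ^ (P + n))⁻¹)) := by
        rw [norm_mul]
        gcongr
        exact (h _).trans (mul_le_mul_of_nonneg_left h1 hC)
    _ = C * (ε ^ (P + n))⁻¹ * (((1 + ‖ξ‖) ^ P)⁻¹ * ‖H ξ‖) := by
        rw [mul_pow, pow_add (1 + ‖ξ‖)]
        field_simp

theorem integrable_symbol_mul (φ : 𝓢(RSp d, ℂ)) {P : ℕ} {H : RSp d → ℂ} (hH : IsSymbol P H)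
    {ε : ℝ} (hε : ε ∈ Ioo (0 : ℝ) 1) (n : ℕ) :
    Integrable fun ξ => ‖ξ‖ ^ n * ‖H ξ * (𝓕 φ : 𝓢(RSp d, ℂ)) (-(ε • ξ))‖ := by
  obtain ⟨C, hC, h⟩ := norm_symbol_mul_le φ P n
  refine (hH.integrable_weight.const_mul (C * (ε ^ (P + n))⁻¹)).mono'
    ((Continuous.aestronglyMeasurable (by fun_prop)).mul
      (aestronglyMeasurable_symbol_mul φ hH.aestronglyMeasurable ε).norm) (ae_of_all _ fun ξ => ?_)
  rw [Real.norm_of_nonneg (by positivity)]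
  exact h H ε hε ξ

/-- Regularized nets grow at most polynomially in `1 / ε`. -/
theorem symbolNet_moderate_bound (φ : 𝓢(RSp d, ℂ)) {P : ℕ} {H : RSp d → ℂ} (hH : IsSymbol P H)
    (j : ℕ) : ∃ C, 0 ≤ C ∧ ∀ ε ∈ Ioo (0 : ℝ) 1, ∀ x,
      ‖iteratedFDeriv ℝ j (symbolNet φ H ε) x‖ ≤ C * (ε ^ (P + j))⁻¹ := by
  obtain ⟨C, hC, h⟩ := norm_symbol_mul_le φ P j
  refine ⟨(2 * Real.pi) ^ j * (C * ∫ ξ, ((1 + ‖ξ‖) ^ P)⁻¹ * ‖H ξ‖),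
    mul_nonneg (by positivity) (mul_nonneg hC (integral_nonneg fun ξ => by positivity)),
    fun ε hε x => ?_⟩
  refine (norm_iteratedFDeriv_fourier_le_integral (integrable_symbol_mul φ hH hε)
    (aestronglyMeasurable_symbol_mul φ hH.aestronglyMeasurable ε) j x).trans ?_
  rw [mul_assoc]
  refine mul_le_mul_of_nonneg_left ?_ (by positivity)
  refine (integral_mono (integrable_symbol_mul φ hH hε j)
    (hH.integrable_weight.const_mul _) fun ξ => h H ε hε ξ).trans_eq ?_
  rw [integral_const_mul]; ring

/-- If the symbol is rapidly decreasing, the regularized net is bounded together with all its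
derivatives. -/
theorem symbolNet_bounded (φ : 𝓢(RSp d, ℂ)) {H : RSp d → ℂ} (hm : AEStronglyMeasurable H volume)
    (hH : ∀ n : ℕ, Integrable fun ξ => ‖ξ‖ ^ n * ‖H ξ‖) (j : ℕ) :
    ∃ C, 0 ≤ C ∧ ∀ ε x, ‖iteratedFDeriv ℝ j (symbolNet φ H ε) x‖ ≤ C := by
  obtain ⟨C, hC, h⟩ := schwartz_decay_zero (𝓕 φ : 𝓢(RSp d, ℂ)) 0
  refine ⟨(2 * Real.pi) ^ j * (C * ∫ ξ, ‖ξ‖ ^ j * ‖H ξ‖),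
    mul_nonneg (by positivity) (mul_nonneg hC (integral_nonneg fun ξ => by positivity)),
    fun ε x => ?_⟩
  have hle : ∀ n (ξ : RSp d), ‖ξ‖ ^ n * ‖H ξ * (𝓕 φ : 𝓢(RSp d, ℂ)) (-(ε • ξ))‖ ≤
      C * (‖ξ‖ ^ n * ‖H ξ‖) := fun n ξ => by
    have := h (-(ε • ξ))
    simp only [pow_zero, inv_one, mul_one] at this
    rw [norm_mul, mul_comm C, mul_assoc]
    gcongr
  have hi : ∀ n : ℕ, Integrable fun ξ : RSp d =>
      ‖ξ‖ ^ n * ‖H ξ * (𝓕 φ : 𝓢(RSp d, ℂ)) (-(ε • ξ))‖ := fun n => by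
    refine ((hH n).const_mul C).mono'
      ((Continuous.aestronglyMeasurable (by fun_prop)).mul
        (aestronglyMeasurable_symbol_mul φ hm ε).norm) (ae_of_all _ fun ξ => ?_)
    rw [Real.norm_of_nonneg (by positivity)]
    exact hle n ξ
  refine (norm_iteratedFDeriv_fourier_le_integral hi
    (aestronglyMeasurable_symbol_mul φ hm ε) j x).trans ?_
  refine mul_le_mul_of_nonneg_left ?_ (by positivity)
  refine (integral_mono (hi j) ((hH j).const_mul C) (hle j)).trans_eq ?_
  rw [integral_const_mul]

theorem contDiff_symbolNet (φ : 𝓢(RSp d, ℂ)) {P : ℕ} {H : RSp d → ℂ} (hH : IsSymbol P H)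
    {ε : ℝ} (hε : ε ∈ Ioo (0 : ℝ) 1) : ContDiff ℝ ∞ (symbolNet φ H ε) :=
  Real.contDiff_fourier (N := ⊤) fun n _ => integrable_symbol_mul φ hH hε n

theorem isSmoothNet_symbolNet (φ : 𝓢(RSp d, ℂ)) {P : ℕ} {H : RSp d → ℂ} (hH : IsSymbol P H) :
    IsSmoothNet ⊤ (symbolNet φ H) := by
  refine ⟨fun ε hε => (contDiff_symbolNet φ hH hε).contDiffOn, fun j => ?_⟩
  obtain ⟨C, hC, hle⟩ := norm_symbol_mul_le φ P j
  have hopen : IsOpen (Ioo (0 : ℝ) 1 ×ˢ ((⊤ : Opens (RSp d)) : Set (RSp d))) :=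
    isOpen_Ioo.prod (⊤ : Opens (RSp d)).isOpen
  set G : ℝ × RSp d → RSp d → ContinuousMultilinearMap ℝ (fun _ : Fin j => RSp d) ℂ := fun z v =>
    Real.fourierChar (-inner ℝ v z.2) • VectorFourier.fourierPowSMulRight (innerSL ℝ)
      (fun ξ => H ξ * (𝓕 φ : 𝓢(RSp d, ℂ)) (-(z.1 • ξ))) v j with hG
  have hcongr : ∀ z ∈ Ioo (0 : ℝ) 1 ×ˢ ((⊤ : Opens (RSp d)) : Set (RSp d)),
      iteratedFDeriv ℝ j (symbolNet φ H z.1) z.2 = ∫ v, G z v := by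
    intro z hz
    rw [symbolNet, Real.iteratedFDeriv_fourier (N := ⊤)
      (fun n _ => integrable_symbol_mul φ hH hz.1 n)
      (aestronglyMeasurable_symbol_mul φ hH.aestronglyMeasurable z.1) le_top, Real.fourier_eq]
  refine ContinuousOn.congr (fun z₀ hz₀ => ContinuousAt.continuousWithinAt ?_) hcongr
  have hz₀' := hz₀.1
  have hev : ∀ᶠ z : ℝ × RSp d in nhds z₀, z.1 ∈ Ioo (z₀.1 / 2) 1 :=
    continuous_fst.continuousAt.eventually
      (Ioo_mem_nhds (half_lt_self hz₀'.1) hz₀'.2)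
  refine continuousAt_of_dominated
    (bound := fun v => (2 * Real.pi) ^ j * (C * ((z₀.1 / 2) ^ (P + j))⁻¹ *
      (((1 + ‖v‖) ^ P)⁻¹ * ‖H v‖))) ?_ ?_ ?_ ?_
  · refine Filter.Eventually.of_forall fun z => ?_
    refine AEStronglyMeasurable.smul (Continuous.aestronglyMeasurable (by fun_prop))
      ((aestronglyMeasurable_symbol_mul φ hH.aestronglyMeasurable z.1).fourierPowSMulRight _ j)
  · filter_upwards [hev] with z hz
    have hz0 : 0 < z.1 := (half_pos hz₀'.1).trans hz.1
    refine ae_of_all _ fun v => ?_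
    rw [hG]
    simp only
    rw [Circle.norm_smul]
    refine (VectorFourier.norm_fourierPowSMulRight_le _ _ v j).trans ?_
    rw [mul_assoc]
    refine mul_le_mul ?_ ((hle H z.1 ⟨hz0, hz.2⟩ v).trans ?_) (by positivity) (by positivity)
    · refine pow_le_pow_left₀ (by positivity) ?_ j
      exact mul_le_of_le_one_right (by positivity) (norm_innerSL_le ℝ)
    · have h1 := half_pos hz₀'.1
      have h2 := hz.1.le
      gcongr
  · exact (hH.integrable_weight.const_mul _).const_mul _
  · refine ae_of_all _ fun v => Continuous.continuousAt ?_
    rw [hG]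
    simp_rw [VectorFourier.fourierPowSMulRight_eq_comp]
    refine Continuous.smul (by fun_prop) (Continuous.fun_const_smul ?_ _)
    exact (ContinuousLinearMap.continuous _).comp (by fun_prop)

/-- Differentiating in `x` amounts to differentiating the mollifier. -/
theorem iteratedFDeriv_symbolNet_apply (φ : 𝓢(RSp d, ℂ)) {P : ℕ} {H : RSp d → ℂ}
    (hH : IsSymbol P H) {ε : ℝ} (hε : ε ∈ Ioo (0 : ℝ) 1) {j : ℕ} (m : Fin j → RSp d)
    (x : RSp d) :
    iteratedFDeriv ℝ j (symbolNet φ H ε) x m =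
      (ε ^ j)⁻¹ • symbolNet (∂^{m} φ) H ε x := by
  have hp := hε.1
  rw [symbolNet, Real.iteratedFDeriv_fourier (N := ⊤)
    (fun n _ => integrable_symbol_mul φ hH hε n)
    (aestronglyMeasurable_symbol_mul φ hH.aestronglyMeasurable ε) le_top,
    Real.fourier_continuousMultilinearMap_apply (VectorFourier.integrable_fourierPowSMulRight _
      (integrable_symbol_mul φ hH hε j)
      (aestronglyMeasurable_symbol_mul φ hH.aestronglyMeasurable ε)), symbolNet, Real.fourier_eq,
    Real.fourier_eq, ← integral_smul]
  refine integral_congr_ae (ae_of_all _ fun ξ => ?_)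
  have hint : ∀ n : ℕ, Integrable (iteratedFDeriv ℝ n φ) volume := fun n => by
    have := φ.integrable_pow_mul_iteratedFDeriv volume 0 n
    simp only [pow_zero, one_mul] at this
    have hc : Continuous (iteratedFDeriv ℝ n φ) :=
      (φ.smooth ⊤).continuous_iteratedFDeriv (by exact_mod_cast le_top)
    exact (integrable_norm_iff hc.aestronglyMeasurable).1 this
  have key : (𝓕 (∂^{m} φ) : 𝓢(RSp d, ℂ)) (-(ε • ξ)) =
      (ε ^ j : ℝ) • ((-(2 * Real.pi * Complex.I)) ^ j • (∏ i, inner ℝ ξ (m i)) •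
        (𝓕 φ : 𝓢(RSp d, ℂ)) (-(ε • ξ))) := by
    have e1 : ((∂^{m} φ : 𝓢(RSp d, ℂ)) : RSp d → ℂ) = fun y => iteratedFDeriv ℝ j φ y m := by
      ext y; exact SchwartzMap.iteratedLineDerivOp_eq_iteratedFDeriv
    rw [SchwartzMap.fourier_coe, e1, ← Real.fourier_continuousMultilinearMap_apply (hint j),
      Real.fourier_iteratedFDeriv (N := ⊤) (φ.smooth ⊤) (fun n _ => hint n) le_top,
      VectorFourier.fourierPowSMulRight_apply, SchwartzMap.fourier_coe]
    have e2 : ∏ i, (-innerSL ℝ) (-(ε • ξ)) (m i) = ε ^ j * ∏ i, inner ℝ ξ (m i) := by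
      have e3 : ε ^ j = ∏ _i : Fin j, ε := by simp
      rw [e3, ← Finset.prod_mul_distrib]
      refine Finset.prod_congr rfl fun i _ => ?_
      simp
    rw [e2, mul_smul, smul_comm ((-(2 * Real.pi * Complex.I)) ^ j) (ε ^ j : ℝ)]
  have e4 : ∏ i, innerSL ℝ ξ (m i) = ∏ i, inner ℝ ξ (m i) := rfl
  simp only [VectorFourier.fourierPowSMulRight_apply]
  rw [e4, key, smul_comm ((ε ^ j)⁻¹ : ℝ), mul_smul_comm, inv_smul_smul₀ (by positivity)]
  congr 1
  simp only [smul_eq_mul, Complex.real_smul]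
  ring

end SymbolNet

/-! ### Decay of mollified nets off the support -/

section OffSupport

open scoped FourierTransform LineDeriv

variable {Ω : Opens (RSp d)}

theorem norm_iteratedFDeriv_mollifierAt_le (φ : 𝓢(RSp d, ℂ)) {ε : ℝ} (hε : 0 < ε)
    (x y : RSp d) (j : ℕ) :
    ‖iteratedFDeriv ℝ j (mollifierAt φ ε hε.ne' x) y‖ ≤
      (ε ^ (d + j))⁻¹ * ‖iteratedFDeriv ℝ j φ (ε⁻¹ • (x - y))‖ := by
  set A : RSp d →L[ℝ] RSp d := (-ε⁻¹) • ContinuousLinearMap.id ℝ (RSp d) with hA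
  have e1 : (mollifierAt φ ε hε.ne' x : RSp d → ℂ) =
      ((ε ^ d)⁻¹ : ℝ) • fun y => (φ ∘ A) (y - x) := rfl
  have hcd : ContDiff ℝ ∞ (φ ∘ A) := (φ.smooth ⊤).comp A.contDiff
  have hnA : ‖A‖ ≤ ε⁻¹ := by
    rw [hA]
    rw [norm_smul, norm_neg, Real.norm_of_nonneg (by positivity)]
    exact mul_le_of_le_one_right (by positivity) ContinuousLinearMap.norm_id_le
  have hAy : A (y - x) = ε⁻¹ • (x - y) := by
    simp [hA, ← smul_neg]
  rw [e1, iteratedFDeriv_const_smul_apply, iteratedFDeriv_comp_sub,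
    A.iteratedFDeriv_comp_right (φ.smooth ⊤) _ (i := j) (by exact_mod_cast le_top), norm_smul,
    Real.norm_of_nonneg (by positivity), hAy, pow_add, mul_inv, mul_assoc]
  · refine mul_le_mul_of_nonneg_left ?_ (by positivity)
    refine (ContinuousMultilinearMap.norm_compContinuousLinearMap_le _ _).trans ?_
    rw [Finset.prod_const, Finset.card_univ, Fintype.card_fin, mul_comm, ← inv_pow]
    gcongr
  · exact ((hcd.comp (contDiff_id.sub contDiff_const)).of_le
      (by exact_mod_cast le_top)).contDiffAt

/-- Away from the support of `χ`, the convolution `(χ T) ∗ φ_ε` decays faster than any power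
of `ε`. -/
theorem localized_mollifierAt_decay (T : 𝓓'(Ω, ℂ)) (χ : 𝓓(Ω, ℝ)) (φ : 𝓢(RSp d, ℂ)) {δ : ℝ}
    (hδ : 0 < δ) (a : ℕ) :
    ∃ C, 0 ≤ C ∧ ∀ (ε : ℝ) (hε : ε ∈ Ioo (0 : ℝ) 1) (x : RSp d),
      (∀ y ∈ tsupport χ, δ ≤ ‖x - y‖) →
      ‖localized T χ (mollifierAt φ ε hε.1.ne' x)‖ ≤ C * ε ^ a := by
  obtain ⟨N, C, hC, hb⟩ := localized_bound T χ
  set Q := a + d + N with hQ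
  choose D hD hdec using fun j => schwartz_decay φ j Q
  set B := ∑ j ∈ Finset.range (N + 1), D j with hB
  have hB0 : 0 ≤ B := Finset.sum_nonneg fun j _ => hD j
  refine ⟨C * (B * (δ ^ Q)⁻¹), by positivity, fun ε hε x hx => ?_⟩
  have hp := hε.1
  rw [mul_assoc]
  refine hb _ _ (by positivity) fun j hj y hy => ?_
  refine (norm_iteratedFDeriv_mollifierAt_le φ hp x y j).trans ?_
  have h1 : δ / ε ≤ 1 + ‖ε⁻¹ • (x - y)‖ := by
    rw [norm_smul, Real.norm_of_nonneg (by positivity), div_eq_inv_mul]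
    have := mul_le_mul_of_nonneg_left (hx y hy) (inv_nonneg.2 hp.le)
    linarith
  have h2 : ‖iteratedFDeriv ℝ j φ (ε⁻¹ • (x - y))‖ ≤ B * ((δ / ε) ^ Q)⁻¹ := by
    refine (hdec j _).trans (mul_le_mul ?_ ?_ (by positivity) hB0)
    · exact Finset.single_le_sum (f := D) (fun j _ => hD j)
        (Finset.mem_range.2 (Nat.lt_succ_of_le hj))
    · gcongr
  have h3 : (ε ^ (d + j))⁻¹ ≤ (ε ^ (d + N))⁻¹ := by
    gcongr ?_⁻¹
    exact pow_le_pow_of_le_one hp.le hε.2.le (by omega)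
  calc (ε ^ (d + j))⁻¹ * ‖iteratedFDeriv ℝ j φ (ε⁻¹ • (x - y))‖
      ≤ (ε ^ (d + N))⁻¹ * (B * ((δ / ε) ^ Q)⁻¹) := by gcongr
    _ = B * (δ ^ Q)⁻¹ * ε ^ a := by
      rw [div_pow, inv_div, hQ, show a + d + N = a + (d + N) by ring, pow_add ε]
      field_simp
      ring

theorem norm_le_sum_single {j : ℕ} (M : ContinuousMultilinearMap ℝ (fun _ : Fin j => RSp d) ℂ) :
    ‖M‖ ≤ ∑ m : Fin j → Fin d, ‖M fun i => EuclideanSpace.single (m i) (1 : ℝ)‖ := by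
  classical
  refine M.opNorm_le_bound (Finset.sum_nonneg fun m _ => norm_nonneg _) fun v => ?_
  have hv : v = fun i => ∑ l : Fin d, v i l • EuclideanSpace.single l (1 : ℝ) := by
    funext i
    ext l
    simp [Pi.single_apply]
  conv_lhs => rw [hv]
  have h1 : M (fun i => ∑ l : Fin d, v i l • EuclideanSpace.single l (1 : ℝ)) =
      ∑ m : Fin j → Fin d, (∏ i, v i (m i)) • M fun i => EuclideanSpace.single (m i) (1 : ℝ) := by
    rw [M.map_sum]
    exact Finset.sum_congr rfl fun m _ => M.map_smul_univ _ _
  rw [h1, Finset.sum_mul]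
  refine (norm_sum_le _ _).trans (Finset.sum_le_sum fun m _ => ?_)
  rw [norm_smul, mul_comm]
  refine mul_le_mul_of_nonneg_left ?_ (norm_nonneg _)
  rw [norm_prod]
  exact Finset.prod_le_prod (fun i _ => norm_nonneg _) fun i _ =>
    PiLp.norm_apply_le (v i) (m i)

theorem norm_pderiv_le {j : ℕ} (m : Fin j → Fin d) (g : RSp d → ℂ) (x : RSp d) :
    ‖pderiv m g x‖ ≤ ‖iteratedFDeriv ℝ j g x‖ := by
  refine (ContinuousMultilinearMap.le_opNorm _ _).trans ?_
  simp

/-- Derivative version of `localized_mollifierAt_decay`, uniformly on compact sets. -/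
theorem mollifiedNet_decay (φ : 𝓢(RSp d, ℂ)) (χ : 𝓓(Ω, ℝ)) (T : 𝓓'(Ω, ℂ)) {U : Opens (RSp d)}
    (hχ : ∀ x ∈ U, χ x = 0) {K : Set (RSp d)} (hK : IsCompact K) (hKU : K ⊆ U) (j a : ℕ) :
    ∃ C, 0 ≤ C ∧ ∀ ε ∈ Ioo (0 : ℝ) 1, ∀ x ∈ K,
      ‖iteratedFDeriv ℝ j (mollifiedNet φ χ T ε) x‖ ≤ C * ε ^ a := by
  obtain ⟨δ, hδ, hsub⟩ := hK.exists_cthickening_subset_open U.isOpen hKU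
  have hdist : ∀ x ∈ K, ∀ y ∈ tsupport χ, δ ≤ ‖x - y‖ := by
    intro x hx y hy
    by_contra! hlt
    have hyU : y ∈ U := hsub (Metric.mem_cthickening_of_dist_le y x δ K hx (by
      rw [dist_comm, dist_eq_norm]; exact hlt.le))
    refine notMem_tsupport_iff_eventuallyEq.2 ?_ hy
    filter_upwards [U.isOpen.mem_nhds hyU] with z hz using hχ z hz
  obtain ⟨P, H, hH, hrep⟩ := exists_symbol T χ
  choose C hC hdec using fun m : Fin j → Fin d =>
    localized_mollifierAt_decay T χ (∂^{fun i => EuclideanSpace.single (m i) (1 : ℝ)} φ) hδ (a + j)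
  refine ⟨∑ m, C m, Finset.sum_nonneg fun m _ => hC m, fun ε hε x hx => ?_⟩
  have hp := hε.1
  rw [mollifiedNet_eq_symbolNet φ hrep hp, Finset.sum_mul]
  refine (norm_le_sum_single _).trans (Finset.sum_le_sum fun m _ => ?_)
  rw [iteratedFDeriv_symbolNet_apply φ hH hε, ← mollifiedNet_eq_symbolNet _ hrep hp,
    mollifiedNet_eq_localized _ _ _ hp.ne', norm_smul, Real.norm_of_nonneg (by positivity)]
  refine (mul_le_mul_of_nonneg_left (hdec m ε hε x (hdist x hx)) (by positivity)).trans_eq ?_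
  rw [pow_add]
  field_simp

end OffSupport

/-! ### Regular distributions -/

section Regular

open scoped FourierTransform

variable {Ω : Opens (RSp d)}

theorem toDistribution_apply {f : RSp d → ℂ} (hf : ContinuousOn f Ω) (ρ : 𝓓(Ω, ℝ)) :
    toDistribution Ω f ρ = ∫ x, ρ x • f x :=
  TestFunction.integralAgainstBilinCLM_eq_integral
    (hf.locallyIntegrableOn Ω.isOpen.measurableSet)

theorem contDiff_cutoff_smul {f : RSp d → ℂ} (hf : ContDiffOn ℝ ∞ f Ω) (χ : 𝓓(Ω, ℝ)) :
    ContDiff ℝ ∞ fun x => χ x • f x := by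
  rw [contDiff_iff_contDiffAt]
  intro x
  by_cases hx : x ∈ tsupport χ
  · exact χ.contDiff.contDiffAt.smul (hf.contDiffAt (Ω.isOpen.mem_nhds (χ.tsupport_subset hx)))
  · refine contDiffAt_const (c := 0) |>.congr_of_eventuallyEq ?_
    filter_upwards [notMem_tsupport_iff_eventuallyEq.1 hx] with y hy
    rw [hy, Pi.zero_apply, zero_smul]

theorem pairing_toDistribution {f : RSp d → ℂ} (hf : ContinuousOn f Ω) (ρ : 𝓓(Ω, ℂ)) :
    pairing (toDistribution Ω f) ρ = ∫ x, ρ x * f x := by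
  have hL : LocallyIntegrableOn f Ω volume := hf.locallyIntegrableOn Ω.isOpen.measurableSet
  rw [pairing, toDistribution_apply hf, toDistribution_apply hf, ← integral_const_mul,
    ← integral_add]
  · refine integral_congr_ae (ae_of_all _ fun x => ?_)
    simp only [TestFunction.postcompCLM_apply, Function.comp_apply, Complex.reCLM_apply,
      Complex.imCLM_apply, Complex.real_smul]
    conv_rhs => rw [← Complex.re_add_im (ρ x)]
    ring
  · exact TestFunction.integrable_bilin (ContinuousLinearMap.lsmul ℝ ℝ) hL
      (TestFunction.postcompCLM Complex.reCLM ρ)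
  · exact (TestFunction.integrable_bilin (ContinuousLinearMap.lsmul ℝ ℝ) hL
      (TestFunction.postcompCLM Complex.imCLM ρ)).const_mul Complex.I

/-- The symbol of a localized smooth function is the inverse Fourier transform of a Schwartz
function. -/
theorem exists_schwartz_symbol {f : RSp d → ℂ} (hf : ContDiffOn ℝ ∞ f Ω) (χ : 𝓓(Ω, ℝ)) :
    ∃ g : 𝓢(RSp d, ℂ), ∀ ψ : 𝓢(RSp d, ℂ),
      localized (toDistribution Ω f) χ ψ = ∫ ξ, g ξ * (𝓕 ψ : 𝓢(RSp d, ℂ)) ξ := by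
  have hc : HasCompactSupport fun x => χ x • f x := χ.hasCompactSupport.smul_right
  set g : 𝓢(RSp d, ℂ) := hc.toSchwartzMap (contDiff_cutoff_smul hf χ) with hg
  refine ⟨(𝓕⁻ g : 𝓢(RSp d, ℂ)), fun ψ => ?_⟩
  rw [SchwartzMap.integral_fourierInv_mul_eq, FourierTransform.fourierInv_fourier_eq]
  change pairing _ _ = _
  rw [pairing_toDistribution hf.continuousOn]
  refine integral_congr_ae (ae_of_all _ fun x => ?_)
  change (χ x • ψ x) * f x = (χ x • f x) * ψ x
  rw [smul_mul_assoc, smul_mul_assoc, mul_comm]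

end Regular

/-! ### Moderate and negligible nets from pointwise bounds -/

section Growth

theorem growthNorm_congr {U : Opens (RSp d)} {f g : Net d}
    (h : ∀ ε ∈ Ioo (0 : ℝ) 1, EqOn (f ε) (g ε) U) (p q : ℝ≥0∞) (k : ℕ) (s : ℝ) :
    growthNorm p q k s U f = growthNorm p q k s U g := by
  refine eLpNorm_congr_ae ?_
  filter_upwards [ae_dlog_mem] with ε hε
  have h1 : sobolevNorm k p U (f ε) = sobolevNorm k p U (g ε) := by
    refine iSup_congr fun j => iSup_congr fun m => eLpNorm_congr_ae ?_
    filter_upwards [ae_restrict_mem U.isOpen.measurableSet] with x hx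
    have h2 := (Filter.eventuallyEq_of_mem (U.isOpen.mem_nhds hx) (h ε hε)).iteratedFDeriv ℝ j
    rw [pderiv, pderiv, h2.eq_of_nhds]
  rw [h1]

theorem IsSmoothNet.congr {U : Opens (RSp d)} {f g : Net d} (hf : IsSmoothNet U f)
    (h : ∀ ε ∈ Ioo (0 : ℝ) 1, EqOn (g ε) (f ε) U) : IsSmoothNet U g := by
  refine ⟨fun ε hε => (hf.smooth ε hε).congr (h ε hε), fun j => (hf.cont j).congr fun z hz => ?_⟩
  exact ((Filter.eventuallyEq_of_mem (U.isOpen.mem_nhds hz.2) (h z.1 hz.1)).iteratedFDeriv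
    ℝ j).eq_of_nhds

theorem mem_negligibleNets_congr {p q : ℝ≥0∞} {U : Opens (RSp d)} {f g : Net d}
    (hf : f ∈ negligibleNets p q U) (h : ∀ ε ∈ Ioo (0 : ℝ) 1, EqOn (g ε) (f ε) U) :
    g ∈ negligibleNets p q U :=
  ⟨hf.1.congr h, fun k V hV s =>
    (growthNorm_congr (fun ε hε => (h ε hε).mono hV.le) p q k s).trans_lt (hf.2 k V hV s)⟩

theorem negligibleNets_le_moderateNets (p q : ℝ≥0∞) (U : Opens (RSp d)) :
    negligibleNets p q U ≤ moderateNets p q U :=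
  fun _ hf => ⟨hf.1, fun k V hV => ⟨0, hf.2 k V hV 0⟩⟩

theorem eLpNorm_ofReal_dlog_lt_top {q : ℝ≥0∞} (hq : 1 ≤ q) :
    eLpNorm (fun ε : ℝ => ENNReal.ofReal ε) q dlog < ⊤ := by
  rcases eq_or_ne q ⊤ with rfl | hq'
  · refine lt_of_le_of_lt (b := (1 : ℝ≥0∞)) ?_ ENNReal.one_lt_top
    rw [eLpNorm_exponent_top, eLpNormEssSup_eq_essSup_enorm]
    refine essSup_le_of_ae_le _ ?_
    filter_upwards [ae_dlog_mem] with ε hε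
    rw [enorm_eq_self, ENNReal.ofReal_le_one]
    exact hε.2.le
  · have hq0 : q ≠ 0 := (zero_lt_one.trans_le hq).ne'
    have hq1 : 1 ≤ q.toReal := by
      rw [← ENNReal.toReal_one]
      exact ENNReal.toReal_mono hq' hq
    rw [eLpNorm_lt_top_iff_lintegral_rpow_enorm_lt_top hq0 hq']
    calc ∫⁻ ε, ‖ENNReal.ofReal ε‖ₑ ^ q.toReal ∂dlog
        ≤ ∫⁻ ε, ENNReal.ofReal ε ∂dlog := by
          refine lintegral_mono_ae ?_
          filter_upwards [ae_dlog_mem] with ε hε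
          rw [enorm_eq_self]
          have := ENNReal.rpow_le_rpow_of_exponent_ge
            (ENNReal.ofReal_le_one.2 hε.2.le) hq1
          rwa [ENNReal.rpow_one] at this
      _ = ∫⁻ ε in Ioo (0 : ℝ) 1, ENNReal.ofReal ε⁻¹ * ENNReal.ofReal ε :=
          lintegral_withDensity_eq_lintegral_mul _ (by fun_prop) (by fun_prop)
      _ ≤ ∫⁻ ε in Ioo (0 : ℝ) 1, 1 := by
          refine lintegral_mono_ae ?_
          filter_upwards [ae_restrict_mem measurableSet_Ioo] with ε hε
          rw [← ENNReal.ofReal_mul (by have := hε.1; positivity), inv_mul_cancel₀ hε.1.ne',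
            ENNReal.ofReal_one]
      _ < ⊤ := by simp

/-- A pointwise bound of the derivatives by a constant times `ε^(1-s)` gives a finite growth norm
with weight `ε^s`. -/
theorem growthNorm_lt_top_of_bound {q : ℝ≥0∞} (hq : 1 ≤ q) (p : ℝ≥0∞) {V : Opens (RSp d)}
    (hV : volume (V : Set (RSp d)) < ⊤) {f : Net d} {k : ℕ} {s : ℝ}
    (h : ∀ j ≤ k, ∃ C, 0 ≤ C ∧ ∀ ε ∈ Ioo (0 : ℝ) 1, ∀ x ∈ V,
      ‖iteratedFDeriv ℝ j (f ε) x‖ ≤ C * ε ^ (1 - s)) : growthNorm p q k s V f < ⊤ := by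
  have h' : ∀ j : Fin (k + 1), ∃ C, 0 ≤ C ∧ ∀ ε ∈ Ioo (0 : ℝ) 1, ∀ x ∈ V,
      ‖iteratedFDeriv ℝ j (f ε) x‖ ≤ C * ε ^ (1 - s) := fun j => h j (Nat.lt_succ_iff.1 j.2)
  choose C hC hle using h'
  set B := ∑ j, C j with hB
  set K : ℝ≥0∞ := volume (V : Set (RSp d)) ^ p.toReal⁻¹ * ENNReal.ofReal B with hK
  have hKtop : K ≠ ⊤ := ENNReal.mul_ne_top
    (ENNReal.rpow_ne_top_of_nonneg (by positivity) hV.ne) ENNReal.ofReal_ne_top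
  have hsob : ∀ ε ∈ Ioo (0 : ℝ) 1,
      sobolevNorm k p V (f ε) ≤ K * ENNReal.ofReal (ε ^ (1 - s)) := by
    intro ε hε
    refine iSup_le fun j => iSup_le fun m => ?_
    have hb : ∀ᵐ x ∂volume.restrict (V : Set (RSp d)), ‖pderiv m (f ε) x‖ ≤ B * ε ^ (1 - s) := by
      filter_upwards [ae_restrict_mem V.isOpen.measurableSet] with x hx
      refine (norm_pderiv_le m (f ε) x).trans ((hle j ε hε x hx).trans ?_)
      have := Real.rpow_nonneg hε.1.le (1 - s)
      gcongr
      exact Finset.single_le_sum (f := C) (fun j _ => hC j) (Finset.mem_univ j)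
    refine (eLpNorm_le_of_ae_bound hb).trans_eq ?_
    rw [Measure.restrict_apply_univ, hK, mul_assoc,
      ENNReal.ofReal_mul (Finset.sum_nonneg fun j _ => hC j)]
  refine lt_of_le_of_lt (eLpNorm_le_nnreal_smul_eLpNorm_of_ae_le_mul' (c := K.toNNReal)
    (g := fun ε : ℝ => ENNReal.ofReal ε) ?_ q)
    (ENNReal.mul_lt_top ENNReal.coe_lt_top (eLpNorm_ofReal_dlog_lt_top hq))
  filter_upwards [ae_dlog_mem] with ε hε
  simp only [enorm_eq_self]
  rw [ENNReal.coe_toNNReal hKtop]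
  calc ENNReal.ofReal (ε ^ s) * sobolevNorm k p V (f ε)
      ≤ ENNReal.ofReal (ε ^ s) * (K * ENNReal.ofReal (ε ^ (1 - s))) := by
        gcongr
        exact hsob ε hε
    _ = K * ENNReal.ofReal ε := by
        rw [mul_left_comm, ← ENNReal.ofReal_mul (Real.rpow_nonneg hε.1.le _),
          ← Real.rpow_add hε.1]
        simp

theorem RelCompact.volume_lt_top {U Ω : Opens (RSp d)} (h : RelCompact U Ω) :
    volume (U : Set (RSp d)) < ⊤ :=
  (measure_mono subset_closure).trans_lt h.1.measure_lt_top

end Growth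

section Mollified

variable {Ω : Opens (RSp d)}

theorem mollifiedNet_sub (φ : 𝓢(RSp d, ℂ)) (χ χ' : 𝓓(Ω, ℝ)) (T : 𝓓'(Ω, ℂ)) :
    mollifiedNet φ χ T - mollifiedNet φ χ' T = mollifiedNet φ (χ - χ') T := by
  funext ε x
  change pairing T _ - pairing T _ = pairing T _
  rw [sub_eq_iff_eq_add, ← pairing_add]
  congr 1
  ext y
  change χ y • scaled φ ε (x - y) =
    (χ y - χ' y) • scaled φ ε (x - y) + χ' y • scaled φ ε (x - y)
  rw [sub_smul, sub_add_cancel]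

theorem isSmoothNet_mollifiedNet (φ : 𝓢(RSp d, ℂ)) (χ : 𝓓(Ω, ℝ)) (T : 𝓓'(Ω, ℂ)) :
    IsSmoothNet ⊤ (mollifiedNet φ χ T) := by
  obtain ⟨P, H, hH, hrep⟩ := exists_symbol T χ
  refine (isSmoothNet_symbolNet φ hH).congr fun ε hε => ?_
  rw [mollifiedNet_eq_symbolNet φ hrep hε.1]
  exact fun _ _ => rfl

theorem mollifiedNet_mem_moderateNets {q : ℝ≥0∞} (hq : 1 ≤ q) (p : ℝ≥0∞) (φ : 𝓢(RSp d, ℂ))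
    (χ : 𝓓(Ω, ℝ)) (T : 𝓓'(Ω, ℂ)) (U : Opens (RSp d)) :
    mollifiedNet φ χ T ∈ moderateNets p q U := by
  refine ⟨(isSmoothNet_mollifiedNet φ χ T).mono le_top, fun k V hV => ?_⟩
  obtain ⟨P, H, hH, hrep⟩ := exists_symbol T χ
  refine ⟨P + k + 1, growthNorm_lt_top_of_bound hq p hV.volume_lt_top fun j hj => ?_⟩
  obtain ⟨C, hC, hle⟩ := symbolNet_moderate_bound φ hH j
  refine ⟨C, hC, fun ε hε x _ => ?_⟩
  have hp := hε.1
  rw [mollifiedNet_eq_symbolNet φ hrep hε.1]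
  refine (hle ε hε x).trans (mul_le_mul_of_nonneg_left ?_ hC)
  rw [show (1 : ℝ) - (P + k + 1) = -((P + k : ℕ) : ℝ) by push_cast; ring, Real.rpow_neg hp.le,
    Real.rpow_natCast]
  gcongr ?_⁻¹
  exact pow_le_pow_of_le_one hp.le hε.2.le (by omega)

/-- `(χ T) ∗ φ_ε` is negligible on every open set on which `χ` vanishes. -/
theorem mollifiedNet_mem_negligibleNets {q : ℝ≥0∞} (hq : 1 ≤ q) (p : ℝ≥0∞) (φ : 𝓢(RSp d, ℂ))
    {χ : 𝓓(Ω, ℝ)} (T : 𝓓'(Ω, ℂ)) {U : Opens (RSp d)} (hχ : ∀ x ∈ U, χ x = 0) :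
    mollifiedNet φ χ T ∈ negligibleNets p q U := by
  refine ⟨(isSmoothNet_mollifiedNet φ χ T).mono le_top, fun k V hV s =>
    growthNorm_lt_top_of_bound hq p hV.volume_lt_top fun j _ => ?_⟩
  obtain ⟨C, hC, hle⟩ := mollifiedNet_decay φ χ T hχ hV.1 hV.2 j ⌈1 - s⌉₊
  refine ⟨C, hC, fun ε hε x hx => (hle ε hε x (subset_closure hx)).trans ?_⟩
  rw [← Real.rpow_natCast]
  exact mul_le_mul_of_nonneg_left
    (Real.rpow_le_rpow_of_exponent_ge hε.1 hε.2.le (Nat.le_ceil _)) hC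

theorem growthNorm_mollifiedNet_lt_top {q : ℝ≥0∞} (hq : 1 ≤ q) (p : ℝ≥0∞) (φ : 𝓢(RSp d, ℂ))
    (χ : 𝓓(Ω, ℝ)) {f : RSp d → ℂ} (hf : ContDiffOn ℝ ∞ f Ω) {V : Opens (RSp d)}
    (hV : volume (V : Set (RSp d)) < ⊤) (k : ℕ) :
    growthNorm p q k 1 V (mollifiedNet φ χ (toDistribution Ω f)) < ⊤ := by
  refine growthNorm_lt_top_of_bound hq p hV fun j _ => ?_
  obtain ⟨g, hg⟩ := exists_schwartz_symbol hf χ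
  obtain ⟨C, hC, hle⟩ := symbolNet_bounded φ (H := g) g.continuous.aestronglyMeasurable
    (fun n => g.integrable_pow_mul volume n) j
  refine ⟨C, hC, fun ε hε x _ => ?_⟩
  rw [mollifiedNet_eq_symbolNet φ hg hε.1]
  simpa using hle ε x

end Mollified

section Product

/-- Leibniz rule as a bound on the derivatives of a product with a cut-off function. -/
theorem norm_iteratedFDeriv_cutoff_smul_le {θ : RSp d → ℝ} (hθ : ContDiff ℝ ∞ θ) {g : RSp d → ℂ}
    (hg : ContDiff ℝ ∞ g) (j : ℕ) (x : RSp d) :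
    ‖iteratedFDeriv ℝ j (fun y => θ y • g y) x‖ ≤ ∑ i ∈ Finset.range (j + 1),
      (j.choose i : ℝ) * ‖iteratedFDeriv ℝ i θ x‖ * ‖iteratedFDeriv ℝ (j - i) g x‖ :=
  norm_iteratedFDeriv_smul_le hθ hg x (by exact_mod_cast le_top)

theorem IsSmoothNet.contDiff {f : Net d} (hf : IsSmoothNet ⊤ f) {ε : ℝ}
    (hε : ε ∈ Ioo (0 : ℝ) 1) : ContDiff ℝ ∞ (f ε) :=
  contDiffOn_univ.1 (hf.smooth ε hε)

theorem IsSmoothNet.cutoff_smul {θ : RSp d → ℝ} (hθ : ContDiff ℝ ∞ θ) {G : Net d}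
    (hG : IsSmoothNet ⊤ G) : IsSmoothNet ⊤ fun ε x => θ x • G ε x := by
  refine ⟨fun ε hε => (hθ.smul (hG.contDiff hε)).contDiffOn, fun j z₀ hz₀ => ?_⟩
  have hsub : ∀ ε ∈ Ioo (0 : ℝ) 1, ContDiff ℝ ∞ (G ε - G z₀.1) := fun ε hε =>
    (hG.contDiff hε).sub (hG.contDiff hz₀.1)
  have hz : ContDiff ℝ ∞ fun x => θ x • G z₀.1 x := hθ.smul (hG.contDiff hz₀.1)
  set S := Ioo (0 : ℝ) 1 ×ˢ ((⊤ : Opens (RSp d)) : Set (RSp d)) with hS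
  have htop : ∀ n : ℕ, (n : WithTop ℕ∞) ≤ ((⊤ : ℕ∞) : WithTop ℕ∞) := fun n => by exact_mod_cast le_top
  -- the derivative splits into a part with `ε` frozen and a part controlled by the Leibniz rule
  have hlim : Filter.Tendsto (fun z : ℝ × RSp d => ∑ i ∈ Finset.range (j + 1),
      (j.choose i : ℝ) * ‖iteratedFDeriv ℝ i θ z.2‖ *
        ‖iteratedFDeriv ℝ (j - i) (G z.1 - G z₀.1) z.2‖) (nhdsWithin z₀ S) (nhds 0) := by
    have h0 : (0 : ℝ) = ∑ i ∈ Finset.range (j + 1),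
        (j.choose i : ℝ) * ‖iteratedFDeriv ℝ i θ z₀.2‖ * 0 := by simp
    rw [h0]
    refine tendsto_finsetSum _ fun i _ => ?_
    have h1 : Continuous fun z : ℝ × RSp d => (j.choose i : ℝ) * ‖iteratedFDeriv ℝ i θ z.2‖ :=
      continuous_const.mul ((hθ.continuous_iteratedFDeriv
        (by exact_mod_cast le_top)).comp continuous_snd).norm
    refine Filter.Tendsto.mul (h1.tendsto z₀ |>.mono_left nhdsWithin_le_nhds) ?_
    have hz₀c : Continuous (iteratedFDeriv ℝ (j - i) (G z₀.1)) :=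
      (hG.contDiff hz₀.1).continuous_iteratedFDeriv (htop _)
    have h2 : ContinuousWithinAt (fun z : ℝ × RSp d => iteratedFDeriv ℝ (j - i) (G z.1) z.2 -
        iteratedFDeriv ℝ (j - i) (G z₀.1) z.2) S z₀ :=
      ((hG.cont (j - i)) z₀ hz₀).sub (hz₀c.comp continuous_snd).continuousWithinAt
    have h3 := h2.norm
    rw [ContinuousWithinAt, sub_self, norm_zero] at h3
    refine h3.congr' ?_
    filter_upwards [self_mem_nhdsWithin] with z hz
    rw [iteratedFDeriv_sub_apply]
    · exact (hG.contDiffAt hz.1 hz.2 _)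
    · exact (hG.contDiffAt hz₀.1 hz.2 _)
  have hcont : Continuous fun z : ℝ × RSp d =>
      iteratedFDeriv ℝ j (fun x => θ x • G z₀.1 x) z.2 :=
    (hz.continuous_iteratedFDeriv (by exact_mod_cast le_top)).comp continuous_snd
  have hdiff : Filter.Tendsto (fun z : ℝ × RSp d =>
      iteratedFDeriv ℝ j (fun x => θ x • (G z.1 - G z₀.1) x) z.2) (nhdsWithin z₀ S) (nhds 0) := by
    refine squeeze_zero_norm' ?_ hlim
    filter_upwards [self_mem_nhdsWithin] with z hz
    exact norm_iteratedFDeriv_cutoff_smul_le hθ (hsub z.1 hz.1) j z.2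
  have hsum := (hcont.tendsto z₀ |>.mono_left nhdsWithin_le_nhds).add hdiff
  rw [add_zero] at hsum
  refine hsum.congr' ?_
  filter_upwards [self_mem_nhdsWithin] with z hz'
  rw [← iteratedFDeriv_add_apply]
  · congr 1
    funext x
    simp only [Pi.add_apply, Pi.sub_apply, smul_sub, add_sub_cancel]
  · exact (hz.of_le (by exact_mod_cast le_top)).contDiffAt
  · exact ((hθ.smul (hsub z.1 hz'.1)).of_le (by exact_mod_cast le_top)).contDiffAt

/-- Multiplication by a cut-off function supported where a net is negligible gives a net that is
negligible everywhere. -/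
theorem cutoff_smul_mollifiedNet_mem_negligibleNets {q : ℝ≥0∞} (hq : 1 ≤ q) (p : ℝ≥0∞)
    {Ω : Opens (RSp d)} (φ : 𝓢(RSp d, ℂ)) {χ : 𝓓(Ω, ℝ)} (T : 𝓓'(Ω, ℂ)) {U : Opens (RSp d)}
    (hχ : ∀ x ∈ U, χ x = 0) (θ : 𝓓(Ω, ℝ)) (hθ : tsupport θ ⊆ U) :
    (fun ε x => θ x • mollifiedNet φ χ T ε x : Net d) ∈ negligibleNets p q ⊤ := by
  have hsm := isSmoothNet_mollifiedNet φ χ T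
  refine ⟨hsm.cutoff_smul θ.contDiff, fun k V hV s =>
    growthNorm_lt_top_of_bound hq p hV.volume_lt_top fun j _ => ?_⟩
  have hK : IsCompact (tsupport θ) := θ.hasCompactSupport
  choose C hC hle using fun i => mollifiedNet_decay φ χ T hχ hK hθ i ⌈1 - s⌉₊
  have hbd : ∀ i, ∃ D, ∀ x ∈ tsupport θ, ‖iteratedFDeriv ℝ i θ x‖ ≤ D := fun i =>
    hK.exists_bound_of_continuousOn
      (θ.contDiff.continuous_iteratedFDeriv (by exact_mod_cast le_top)).continuousOn
  choose D hD using hbd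
  refine ⟨∑ i ∈ Finset.range (j + 1), (j.choose i : ℝ) * |D i| * C (j - i),
    Finset.sum_nonneg fun i _ => mul_nonneg (by positivity) (hC _), fun ε hε x _ => ?_⟩
  have hr : ε ^ ⌈1 - s⌉₊ ≤ ε ^ (1 - s) := by
    rw [← Real.rpow_natCast]
    exact Real.rpow_le_rpow_of_exponent_ge hε.1 hε.2.le (Nat.le_ceil _)
  by_cases hx : x ∈ tsupport θ
  · refine (norm_iteratedFDeriv_cutoff_smul_le θ.contDiff (hsm.contDiff hε) j x).trans ?_
    rw [Finset.sum_mul]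
    refine Finset.sum_le_sum fun i _ => ?_
    rw [mul_assoc _ (C (j - i))]
    have h1 := hC (j - i)
    gcongr
    · exact (hD i x hx).trans (le_abs_self _)
    · exact (hle (j - i) ε hε x hx).trans (by gcongr)
  · have h0 : (fun y => θ y • mollifiedNet φ χ T ε y) =ᶠ[nhds x] fun _ => 0 := by
      filter_upwards [notMem_tsupport_iff_eventuallyEq.1 hx] with y hy
      rw [hy, Pi.zero_apply, zero_smul]
    rw [(h0.iteratedFDeriv ℝ j).eq_of_nhds, iteratedFDeriv_fun_zero]
    simp only [Pi.zero_apply, norm_zero]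
    exact mul_nonneg (Finset.sum_nonneg fun i _ => mul_nonneg (by positivity) (hC _))
      (Real.rpow_nonneg hε.1.le _)

end Product

/-! ### Locality along increasing open covers -/

section Locality

variable {Ω : Opens (RSp d)} {U : ℕ → Opens (RSp d)}

theorem exists_relCompact_of_cover (hU : Monotone U) (hcov : ∀ x ∈ Ω, ∃ n, x ∈ U n)
    {V : Opens (RSp d)} (hV : RelCompact V Ω) : ∃ n, RelCompact V (U n) := by
  obtain ⟨n, hn⟩ := hV.1.elim_directed_cover (fun n => (U n : Set (RSp d)))
    (fun n => (U n).isOpen) (fun x hx => mem_iUnion.2 (hcov x (hV.2 hx)))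
    (directed_of_isDirected_le fun _ _ h => hU h)
  exact ⟨n, hV.1, hn⟩

theorem isSmoothNet_of_cover {f : Net d} (hcov : ∀ x ∈ Ω, ∃ n, x ∈ U n)
    (hf : ∀ n, IsSmoothNet (U n) f) : IsSmoothNet Ω f := by
  refine ⟨fun ε hε x hx => ?_, fun j z hz => ?_⟩
  · obtain ⟨n, hn⟩ := hcov x hx
    exact (((hf n).smooth ε hε).contDiffAt ((U n).isOpen.mem_nhds hn)).contDiffWithinAt
  · obtain ⟨n, hn⟩ := hcov z.2 hz.2
    exact (((hf n).cont j).continuousAt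
      ((isOpen_Ioo.prod (U n).isOpen).mem_nhds ⟨hz.1, hn⟩)).continuousWithinAt

theorem mem_moderateNets_of_cover {p q : ℝ≥0∞} (hU : Monotone U)
    (hcov : ∀ x ∈ Ω, ∃ n, x ∈ U n) {f : Net d} (hf : ∀ n, f ∈ moderateNets p q (U n)) :
    f ∈ moderateNets p q Ω := by
  refine ⟨isSmoothNet_of_cover hcov fun n => (hf n).1, fun k V hV => ?_⟩
  obtain ⟨n, hn⟩ := exists_relCompact_of_cover hU hcov hV
  exact (hf n).2 k V hn

theorem mem_negligibleNets_of_cover {p q : ℝ≥0∞} (hU : Monotone U)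
    (hcov : ∀ x ∈ Ω, ∃ n, x ∈ U n) {f : Net d} (hf : ∀ n, f ∈ negligibleNets p q (U n)) :
    f ∈ negligibleNets p q Ω := by
  refine ⟨isSmoothNet_of_cover hcov fun n => (hf n).1, fun k V hV s => ?_⟩
  obtain ⟨n, hn⟩ := exists_relCompact_of_cover hU hcov hV
  exact (hf n).2 k V hn s

/-- Functions that agree along an increasing sequence of sets glue. -/
theorem exists_glue {α β : Type*} [Inhabited β] {U : ℕ → Set α} (hU : Monotone U) {g : ℕ → α → β}
    (h : ∀ n, EqOn (g (n + 1)) (g n) (U n)) : ∃ f : α → β, ∀ n, EqOn f (g n) (U n) := by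
  classical
  have h' : ∀ m n, m ≤ n → EqOn (g n) (g m) (U m) := by
    intro m n hmn
    induction n, hmn using Nat.le_induction with
    | base => exact fun _ _ => rfl
    | succ n hmn ih => exact fun x hx => (h n (hU hmn hx)).trans (ih hx)
  refine ⟨fun x => if hx : ∃ n, x ∈ U n then g (Nat.find hx) x else default, fun n x hx => ?_⟩
  have hex : ∃ n, x ∈ U n := ⟨n, hx⟩
  simp only
  rw [dif_pos hex]
  exact (h' _ n (Nat.find_min' hex hx) (Nat.find_spec hex)).symm

end Locality

/-! ### The embedding of distributions -/

section Embedding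

open scoped Manifold

/-- An increasing sequence of relatively compact open sets exhausting `Ω`, with cut-off functions
`χ n` that are one on the `n`-th set and supported in the next one. -/
structure CutoffExhaustion (Ω : Opens (RSp d)) where
  /-- The exhausting sets. -/
  U : ℕ → Opens (RSp d)
  /-- The cut-off functions. -/
  χ : ℕ → 𝓓(Ω, ℝ)
  relCompact : ∀ n, RelCompact (U n) (U (n + 1))
  le : ∀ n, U n ≤ Ω
  cover : ∀ x ∈ Ω, ∃ n, x ∈ U n
  eq_one : ∀ n, ∀ x ∈ U n, χ n x = 1
  tsupport_subset : ∀ n, tsupport (χ n) ⊆ U (n + 1)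

theorem CutoffExhaustion.monotone {Ω : Opens (RSp d)} (E : CutoffExhaustion Ω) : Monotone E.U :=
  monotone_nat_of_le_succ fun n => (E.relCompact n).le

/-- A smooth cut-off function that is one on a compact set and supported in an open one. -/
theorem exists_cutoff {Ω V : Opens (RSp d)} {K K' : Set (RSp d)} (hK : IsCompact K)
    (hK' : IsCompact K') (hKV : K ⊆ V) (hVK' : (V : Set (RSp d)) ⊆ K') (hVΩ : V ≤ Ω) :
    ∃ χ : 𝓓(Ω, ℝ), (∀ x ∈ K, χ x = 1) ∧ tsupport χ ⊆ V := by
  obtain ⟨f, h0, h1, -⟩ := exists_contMDiffMap_zero_one_nhds_of_isClosed (n := ⊤) 𝓘(ℝ, RSp d)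
    V.isOpen.isClosed_compl hK.isClosed (disjoint_left.2 fun x hx hx' => hx (hKV hx'))
  have hsub : tsupport f ⊆ V := by
    intro x hx
    by_contra hxV
    refine notMem_tsupport_iff_eventuallyEq.2 ?_ hx
    exact h0.filter_mono (nhds_le_nhdsSet hxV)
  refine ⟨⟨f, f.contMDiff.contDiff, ?_, hsub.trans hVΩ⟩, fun x hx => ?_, hsub⟩
  · exact hK'.of_isClosed_subset (isClosed_tsupport _) (hsub.trans hVK')
  · exact h1.self_of_nhdsSet x hx

theorem nonempty_cutoffExhaustion (Ω : Opens (RSp d)) : Nonempty (CutoffExhaustion Ω) := by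
  have : LocallyCompactSpace Ω := Ω.isOpen.locallyCompactSpace
  obtain ⟨K⟩ : Nonempty (CompactExhaustion Ω) := inferInstance
  have hc : ∀ n, IsCompact (Subtype.val '' K n : Set (RSp d)) := fun n =>
    (K.isCompact n).image continuous_subtype_val
  let U : ℕ → Opens (RSp d) := fun n => ⟨interior (Subtype.val '' K n), isOpen_interior⟩
  have hsub : ∀ n, (U n : Set (RSp d)) ⊆ Subtype.val '' K n := fun n => interior_subset
  have hle : ∀ n, U n ≤ Ω := fun n x hx => by
    obtain ⟨y, -, rfl⟩ := hsub n hx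
    exact y.2
  have hKU : ∀ n, Subtype.val '' K n ⊆ (U (n + 1) : Set (RSp d)) := fun n =>
    (image_mono (K.subset_interior_succ n)).trans
      (Ω.isOpen.isOpenMap_subtype_val.image_interior_subset _)
  choose χ h1 h2 using fun n => exists_cutoff (hc n) (hc (n + 1)) (hKU n) (hsub (n + 1))
    (hle (n + 1))
  have hcl : ∀ n, closure (U n : Set (RSp d)) ⊆ Subtype.val '' K n := fun n =>
    closure_minimal (hsub n) (hc n).isClosed
  refine ⟨⟨U, χ, fun n => ⟨(hc n).of_isClosed_subset isClosed_closure (hcl n),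
    (hcl n).trans (hKU n)⟩, hle, fun x hx => ?_, fun n x hx => h1 n x (hsub n hx), h2⟩⟩
  obtain ⟨n, hn⟩ := K.exists_mem ⟨x, hx⟩
  exact ⟨n + 1, hKU n ⟨⟨x, hx⟩, hn, rfl⟩⟩

variable {p q : ℝ≥0∞} {Ω : Opens (RSp d)}

theorem GSpace.mk_eq_mk_iff {f g : moderateNets p q Ω} :
    GSpace.mk f = GSpace.mk g ↔ (f : Net d) - g ∈ negligibleNets p q Ω :=
  Submodule.Quotient.eq _

theorem GSpace.exists_mk (u : GSpace p q Ω) : ∃ f : moderateNets p q Ω, u = GSpace.mk f := by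
  obtain ⟨f, rfl⟩ := Submodule.Quotient.mk_surjective _ u
  exact ⟨f, rfl⟩

theorem GSpace.restrict_mk_eq_iff {U : Opens (RSp d)} (h : U ≤ Ω) {f : moderateNets p q Ω}
    {g : moderateNets p q U} :
    GSpace.restrict h (GSpace.mk f) = GSpace.mk g ↔ (f : Net d) - g ∈ negligibleNets p q U :=
  Submodule.Quotient.eq _

theorem IsEmbeddingOf.unique (φ : 𝓢(RSp d, ℂ)) {T : 𝓓'(Ω, ℂ)} {u v : GSpace p q Ω}
    (hu : IsEmbeddingOf φ T u) (hv : IsEmbeddingOf φ T v) : u = v := by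
  obtain ⟨E⟩ := nonempty_cutoffExhaustion Ω
  obtain ⟨f, rfl⟩ := u.exists_mk
  obtain ⟨g, rfl⟩ := v.exists_mk
  rw [GSpace.mk_eq_mk_iff]
  refine mem_negligibleNets_of_cover E.monotone E.cover fun n => ?_
  obtain ⟨h, hf⟩ := hu (E.U n) (E.le n) (E.χ n) (E.eq_one n)
  obtain ⟨h', hg⟩ := hv (E.U n) (E.le n) (E.χ n) (E.eq_one n)
  rw [GSpace.restrict_mk_eq_iff] at hf hg
  have := sub_mem hf hg
  simpa using this

/-- Nets obtained from two cut-off functions that agree on `U` are equivalent on `U`. -/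
theorem mollifiedNet_sub_mem_negligibleNets (hq : 1 ≤ q) (p : ℝ≥0∞) (φ : 𝓢(RSp d, ℂ))
    (T : 𝓓'(Ω, ℂ)) {χ χ' : 𝓓(Ω, ℝ)} {U : Opens (RSp d)} (h : ∀ x ∈ U, χ x = χ' x) :
    mollifiedNet φ χ T - mollifiedNet φ χ' T ∈ negligibleNets p q U := by
  rw [mollifiedNet_sub]
  refine mollifiedNet_mem_negligibleNets hq p φ T fun x hx => ?_
  change χ x - χ' x = 0
  rw [h x hx, sub_self]

/-- The local nets `(χ T) ∗ φ_ε` patch to a global one: the correction terms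
`χ_n ((χ_{n+2} T) ∗ φ_ε - (χ_{n+1} T) ∗ φ_ε)` are negligible everywhere and make the corrected nets
agree exactly. -/
theorem exists_isEmbeddingOf (hq : 1 ≤ q) (φ : 𝓢(RSp d, ℂ)) (T : 𝓓'(Ω, ℂ)) :
    ∃ u : GSpace p q Ω, IsEmbeddingOf φ T u := by
  obtain ⟨E⟩ := nonempty_cutoffExhaustion Ω
  let F : ℕ → Net d := fun n => mollifiedNet φ (E.χ n) T
  let c : ℕ → Net d := fun n ε x => E.χ n x • (F (n + 2) - F (n + 1)) ε x
  let g : ℕ → Net d := fun N => F (N + 1) - ∑ n ∈ Finset.range N, c n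
  have hc : ∀ n, c n ∈ negligibleNets p q ⊤ := by
    intro n
    have h1 : c n = fun ε x => E.χ n x • mollifiedNet φ (E.χ (n + 2) - E.χ (n + 1)) T ε x := by
      rw [← mollifiedNet_sub]
    rw [h1]
    refine cutoff_smul_mollifiedNet_mem_negligibleNets hq p φ T (U := E.U (n + 1)) (fun x hx => ?_)
      (E.χ n) (E.tsupport_subset n)
    change E.χ (n + 2) x - E.χ (n + 1) x = 0
    rw [E.eq_one (n + 1) x hx, E.eq_one (n + 2) x (E.monotone (Nat.le_succ _) hx), sub_self]
  obtain ⟨f', hf'⟩ := exists_glue (U := fun n => (E.U n : Set (RSp d)))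
    (fun _ _ h => E.monotone h) (g := fun N x ε => g N ε x) (by
      intro N x hx
      funext ε
      simp only [g, Pi.sub_apply, Finset.sum_range_succ, Pi.add_apply, c, E.eq_one N x hx,
        one_smul]
      ring)
  set f : Net d := fun ε x => f' x ε with hfdef
  have hf : ∀ N ε, EqOn (f ε) (g N ε) (E.U N) := fun N ε x hx => congrFun (hf' N hx) ε
  have hdiff : ∀ N, f - F (N + 1) ∈ negligibleNets p q (E.U N) := by
    intro N
    have h1 : -∑ n ∈ Finset.range N, c n ∈ negligibleNets p q (E.U N) :=
      neg_mem (negligibleNets_anti p q le_top (sum_mem fun n _ => hc n))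
    refine mem_negligibleNets_congr h1 fun ε _ x hx => ?_
    change f ε x - F (N + 1) ε x = _
    rw [hf N ε hx]
    simp [g]
  have hmod : f ∈ moderateNets p q Ω := by
    refine mem_moderateNets_of_cover E.monotone E.cover fun N => ?_
    have := add_mem (negligibleNets_le_moderateNets p q _ (hdiff N))
      (mollifiedNet_mem_moderateNets hq p φ (E.χ (N + 1)) T (E.U N))
    simpa [F] using this
  refine ⟨GSpace.mk ⟨f, hmod⟩, fun U hU χ hχ =>
    ⟨mollifiedNet_mem_moderateNets hq p φ χ T U, ?_⟩⟩
  rw [GSpace.restrict_mk_eq_iff]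
  refine mem_negligibleNets_of_cover (U := fun N => U ⊓ E.U N)
    (fun _ _ h => inf_le_inf_left _ (E.monotone h)) (fun x hx => ?_) fun N => ?_
  · obtain ⟨n, hn⟩ := E.cover x (hU hx)
    exact ⟨n, hx, hn⟩
  · have h1 := negligibleNets_anti p q (inf_le_right : U ⊓ E.U N ≤ E.U N) (hdiff N)
    have h2 : F (N + 1) - mollifiedNet φ χ T ∈ negligibleNets p q (U ⊓ E.U N) :=
      mollifiedNet_sub_mem_negligibleNets hq p φ T fun x hx => by
        rw [E.eq_one (N + 1) x (E.monotone (Nat.le_succ _) hx.2), hχ x hx.1]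
    have := add_mem h1 h2
    simpa using this

theorem isEmbeddingOf_iota (hq : 1 ≤ q) (φ : 𝓢(RSp d, ℂ)) (T : 𝓓'(Ω, ℂ)) :
    IsEmbeddingOf φ T (iota p q φ T) :=
  Classical.epsilon_spec (exists_isEmbeddingOf hq φ T)

theorem eq_iota_iff (hq : 1 ≤ q) (φ : 𝓢(RSp d, ℂ)) (T : 𝓓'(Ω, ℂ)) (u : GSpace p q Ω) :
    u = iota p q φ T ↔ IsEmbeddingOf φ T u :=
  ⟨fun h => h ▸ isEmbeddingOf_iota hq φ T, fun h => h.unique φ (isEmbeddingOf_iota hq φ T)⟩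

/-- The image of a smooth function is regular. -/
theorem iota_mem_GInfty (hq : 1 ≤ q) (φ : 𝓢(RSp d, ℂ)) {T : 𝓓'(Ω, ℂ)}
    (hT : T ∈ smoothDistributions Ω) : iota p q φ T ∈ GInfty p q Ω := by
  obtain ⟨f, hf, rfl⟩ := hT
  intro U hU
  obtain ⟨E⟩ := nonempty_cutoffExhaustion Ω
  obtain ⟨n, hn⟩ := exists_relCompact_of_cover E.monotone E.cover hU
  obtain ⟨h, hr⟩ := isEmbeddingOf_iota (p := p) hq φ (toDistribution Ω f) U hU.le (E.χ n)
    fun x hx => E.eq_one n x (hn.le hx)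
  exact ⟨1, fun k => ⟨⟨_, h⟩, fun V hV =>
    growthNorm_mollifiedNet_lt_top hq p φ (E.χ n) hf hV.volume_lt_top k, hr⟩⟩

end Embedding

/-! ### Windowed symbols -/

section Window

open scoped FourierTransform

/-- The Fourier transform of `Θ 𝓕 H`, for a Schwartz window `Θ` and a symbol `H`:
the function `η ↦ ∫ H(ξ) 𝓕Θ(ξ + η) dξ`. -/
noncomputable def windowed (Θ : 𝓢(RSp d, ℂ)) (H : RSp d → ℂ) (η : RSp d) : ℂ :=
  ∫ ξ, H ξ * (𝓕 Θ : 𝓢(RSp d, ℂ)) (ξ + η)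

theorem integral_fourier_mul_eq_integral_mul_fourier {f g : RSp d → ℂ} (hf : Integrable f)
    (hg : Integrable g) : ∫ ξ, 𝓕 f ξ * g ξ = ∫ x, f x * 𝓕 g x := by
  have := VectorFourier.integral_fourierIntegral_smul_eq_flip (L := innerₗ (RSp d))
    Real.continuous_fourierChar continuous_inner hf hg
  rwa [flip_innerₗ] at this

theorem fourier_window_mul_fourier (Θ : 𝓢(RSp d, ℂ)) {H : RSp d → ℂ} (hH : Integrable H)
    (η : RSp d) : 𝓕 (fun x => Θ x * 𝓕 H x) η = windowed Θ H η := by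
  have hΘ : Integrable fun x => Real.fourierChar (-inner ℝ x η) • Θ x :=
    (Real.fourierIntegral_convergent_iff η).2 Θ.integrable
  have h1 : 𝓕 (fun x => Θ x * 𝓕 H x) η =
      ∫ x, 𝓕 H x * (Real.fourierChar (-inner ℝ x η) • Θ x) := by
    rw [Real.fourier_eq]
    refine integral_congr_ae (ae_of_all _ fun x => ?_)
    simp only [Circle.smul_def, smul_eq_mul]
    ring
  rw [h1, integral_fourier_mul_eq_integral_mul_fourier hH hΘ, windowed]
  refine integral_congr_ae (ae_of_all _ fun ξ => ?_)
  simp only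
  rw [SchwartzMap.fourier_coe, Real.fourier_eq, Real.fourier_eq]
  congr 1
  refine integral_congr_ae (ae_of_all _ fun x => ?_)
  simp only [Circle.smul_def, smul_smul]
  rw [← Circle.coe_mul, ← AddChar.map_add_eq_mul, inner_add_right]
  congr 3
  ring

theorem one_add_norm_le_mul (ξ η : RSp d) : 1 + ‖ξ‖ ≤ (1 + ‖ξ + η‖) * (1 + ‖η‖) := by
  have h := norm_sub_le (ξ + η) η
  rw [add_sub_cancel_right] at h
  nlinarith [mul_nonneg (norm_nonneg (ξ + η)) (norm_nonneg η)]

theorem norm_fourier_window_le (Θ : 𝓢(RSp d, ℂ)) (Q : ℕ) :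
    ∃ C, 0 ≤ C ∧ ∀ ξ η, ‖(𝓕 Θ : 𝓢(RSp d, ℂ)) (ξ + η)‖ ≤
      C * (1 + ‖η‖) ^ Q * ((1 + ‖ξ‖) ^ Q)⁻¹ := by
  obtain ⟨C, hC, h⟩ := schwartz_decay_zero (𝓕 Θ : 𝓢(RSp d, ℂ)) Q
  refine ⟨C, hC, fun ξ η => (h _).trans ?_⟩
  rw [mul_assoc]
  refine mul_le_mul_of_nonneg_left ?_ hC
  rw [← div_eq_mul_inv, inv_eq_one_div, div_le_div_iff₀ (by positivity) (by positivity), one_mul,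
    mul_comm, ← mul_pow]
  exact pow_le_pow_left₀ (by positivity) (one_add_norm_le_mul ξ η) Q

theorem norm_schwartz_sub_le (g : 𝓢(RSp d, ℂ)) :
    ∃ L, 0 ≤ L ∧ ∀ x y, ‖g x - g y‖ ≤ L * ‖x - y‖ := by
  obtain ⟨L, hL, h⟩ := schwartz_decay g 1 0
  refine ⟨L, hL, fun x y => ?_⟩
  refine Convex.norm_image_sub_le_of_norm_fderiv_le (𝕜 := ℝ) (s := univ)
    (fun z _ => g.differentiableAt) (fun z _ => ?_) convex_univ (mem_univ y) (mem_univ x)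
  have := h z
  rw [norm_iteratedFDeriv_one] at this
  simpa using this

/-- Regularizing the symbol with parameter `ε` changes the windowed symbol by a multiple of
`ε`, up to polynomial growth; this is where `∫ φ = 1` is used. -/
theorem norm_windowed_sub_le {φ : 𝓢(RSp d, ℂ)} (hφ : ∫ x, φ x = 1) (Θ : 𝓢(RSp d, ℂ)) {P : ℕ}
    {H : RSp d → ℂ} (hH : IsSymbol P H) :
    ∃ C, 0 ≤ C ∧ ∀ ε ∈ Ioo (0 : ℝ) 1, ∀ η,
      ‖windowed Θ H η - windowed Θ (fun ξ => H ξ * (𝓕 φ : 𝓢(RSp d, ℂ)) (-(ε • ξ))) η‖ ≤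
        C * ε * (1 + ‖η‖) ^ (P + 1) := by
  obtain ⟨C, hC, hΘ⟩ := norm_fourier_window_le Θ (P + 1)
  obtain ⟨C', hC', hΘ'⟩ := norm_fourier_window_le Θ P
  obtain ⟨L, hL, hlip⟩ := norm_schwartz_sub_le (𝓕 φ : 𝓢(RSp d, ℂ))
  have h0 : (𝓕 φ : 𝓢(RSp d, ℂ)) 0 = 1 := by
    rw [SchwartzMap.fourier_coe, Real.fourier_eq]
    simpa using hφ
  set J := ∫ ξ, ((1 + ‖ξ‖) ^ P)⁻¹ * ‖H ξ‖ with hJ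
  have hJ0 : 0 ≤ J := integral_nonneg fun ξ => by positivity
  refine ⟨L * C * J, by positivity, fun ε hε η => ?_⟩
  have hp := hε.1
  have hm : ∀ K : RSp d → ℂ, AEStronglyMeasurable K volume →
      AEStronglyMeasurable (fun ξ => K ξ * (𝓕 Θ : 𝓢(RSp d, ℂ)) (ξ + η)) volume := fun K hK =>
    hK.mul (Continuous.aestronglyMeasurable (by fun_prop))
  have hi : Integrable fun ξ => H ξ * (𝓕 Θ : 𝓢(RSp d, ℂ)) (ξ + η) := by
    refine (hH.integrable_weight.const_mul (C' * (1 + ‖η‖) ^ P)).mono'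
      (hm H hH.aestronglyMeasurable) (ae_of_all _ fun ξ => ?_)
    rw [norm_mul, mul_comm]
    refine (mul_le_mul_of_nonneg_right (hΘ' ξ η) (norm_nonneg _)).trans_eq (by ring)
  have hi' : Integrable fun ξ => H ξ * (𝓕 φ : 𝓢(RSp d, ℂ)) (-(ε • ξ)) *
      (𝓕 Θ : 𝓢(RSp d, ℂ)) (ξ + η) := by
    obtain ⟨B, hB, hb⟩ := schwartz_decay_zero (𝓕 φ : 𝓢(RSp d, ℂ)) 0
    refine (hi.norm.const_mul B).mono'
      (hm _ (aestronglyMeasurable_symbol_mul φ hH.aestronglyMeasurable ε))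
      (ae_of_all _ fun ξ => ?_)
    have := hb (-(ε • ξ))
    simp only [pow_zero, inv_one, mul_one] at this
    rw [norm_mul, norm_mul, norm_mul, mul_comm ‖H ξ‖, mul_assoc]
    gcongr
  rw [windowed, windowed, ← integral_sub hi hi']
  refine (norm_integral_le_of_norm_le
    (hH.integrable_weight.const_mul (L * C * ε * (1 + ‖η‖) ^ (P + 1)))
    (ae_of_all _ fun ξ => ?_)).trans_eq ?_
  · have e : H ξ * (𝓕 Θ : 𝓢(RSp d, ℂ)) (ξ + η) - H ξ * (𝓕 φ : 𝓢(RSp d, ℂ)) (-(ε • ξ)) *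
        (𝓕 Θ : 𝓢(RSp d, ℂ)) (ξ + η) = H ξ * ((𝓕 φ : 𝓢(RSp d, ℂ)) 0 -
        (𝓕 φ : 𝓢(RSp d, ℂ)) (-(ε • ξ))) * (𝓕 Θ : 𝓢(RSp d, ℂ)) (ξ + η) := by
      rw [h0]; ring
    have hl : ‖(𝓕 φ : 𝓢(RSp d, ℂ)) 0 - (𝓕 φ : 𝓢(RSp d, ℂ)) (-(ε • ξ))‖ ≤
        L * (ε * (1 + ‖ξ‖)) := by
      refine (hlip _ _).trans (mul_le_mul_of_nonneg_left ?_ hL)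
      rw [zero_sub, neg_neg, norm_smul, Real.norm_of_nonneg hp.le]
      gcongr
      linarith
    rw [e, norm_mul, norm_mul]
    calc ‖H ξ‖ * ‖(𝓕 φ : 𝓢(RSp d, ℂ)) 0 - (𝓕 φ : 𝓢(RSp d, ℂ)) (-(ε • ξ))‖ *
          ‖(𝓕 Θ : 𝓢(RSp d, ℂ)) (ξ + η)‖
        ≤ ‖H ξ‖ * (L * (ε * (1 + ‖ξ‖))) *
          (C * (1 + ‖η‖) ^ (P + 1) * ((1 + ‖ξ‖) ^ (P + 1))⁻¹) := by
          gcongr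
          exact hΘ ξ η
      _ = L * C * ε * (1 + ‖η‖) ^ (P + 1) * (((1 + ‖ξ‖) ^ P)⁻¹ * ‖H ξ‖) := by
          rw [pow_succ (1 + ‖ξ‖)]
          field_simp
  · rw [integral_const_mul]; ring

theorem aestronglyMeasurable_windowed (Θ : 𝓢(RSp d, ℂ)) {H : RSp d → ℂ}
    (hH : AEStronglyMeasurable H volume) : AEStronglyMeasurable (windowed Θ H) volume := by
  have h : AEStronglyMeasurable (fun z : RSp d × RSp d =>
      H z.2 * (𝓕 Θ : 𝓢(RSp d, ℂ)) (z.2 + z.1)) (volume.prod volume) :=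
    hH.comp_snd.mul (Continuous.aestronglyMeasurable (by fun_prop))
  exact h.integral_prod_right'

/-- `⟨𝓕 H, Θ 𝓕 σ⟩ = ⟨𝓕 (Θ 𝓕 H), σ⟩`. -/
theorem integral_mul_fourier_window_mul (Θ σ : 𝓢(RSp d, ℂ)) {P : ℕ} {H : RSp d → ℂ}
    (hH : IsSymbol P H) :
    ∫ ξ, H ξ * 𝓕 (fun x => Θ x * 𝓕 (σ : RSp d → ℂ) x) ξ = ∫ η, σ η * windowed Θ H η := by
  obtain ⟨C, hC, hΘ⟩ := norm_fourier_window_le Θ P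
  -- the weights `(1 + ‖ξ‖) ^ (-P)` and `(1 + ‖η‖) ^ P` separate the variables
  have hσ : Integrable fun η : RSp d => (1 + ‖η‖) ^ P * ‖σ η‖ := by
    obtain ⟨B, hB, hb⟩ := schwartz_decay_zero σ (P + (d + 1))
    have hint : Integrable fun η : RSp d => (1 + ‖η‖) ^ (-(d + 1 : ℝ)) :=
      integrable_one_add_norm (by simp)
    refine (hint.const_mul B).mono' (Continuous.aestronglyMeasurable (by fun_prop))
      (ae_of_all _ fun η => ?_)
    rw [Real.norm_of_nonneg (by positivity), Real.rpow_neg (by positivity),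
      show (d + 1 : ℝ) = ((d + 1 : ℕ) : ℝ) by push_cast; ring, Real.rpow_natCast]
    refine (mul_le_mul_of_nonneg_left (hb η) (by positivity)).trans_eq ?_
    rw [pow_add]
    field_simp
  have hprod : Integrable (fun z : RSp d × RSp d =>
      H z.1 * (σ z.2 * (𝓕 Θ : 𝓢(RSp d, ℂ)) (z.2 + z.1))) (volume.prod volume) := by
    refine ((hH.integrable_weight.mul_prod hσ).const_mul C).mono'
      (hH.aestronglyMeasurable.comp_fst.mul (Continuous.aestronglyMeasurable (by fun_prop)))
      (ae_of_all _ fun z => ?_)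
    rw [norm_mul, norm_mul, add_comm]
    refine (mul_le_mul_of_nonneg_left (mul_le_mul_of_nonneg_left (hΘ z.1 z.2) (norm_nonneg _))
      (norm_nonneg _)).trans_eq (by ring)
  have h1 : ∀ ξ, H ξ * 𝓕 (fun x => Θ x * 𝓕 (σ : RSp d → ℂ) x) ξ =
      ∫ η, H ξ * (σ η * (𝓕 Θ : 𝓢(RSp d, ℂ)) (η + ξ)) := fun ξ => by
    rw [fourier_window_mul_fourier Θ σ.integrable, windowed, integral_const_mul]
  simp_rw [h1]
  rw [integral_integral_swap hprod]
  refine integral_congr_ae (ae_of_all _ fun η => ?_)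
  simp only
  rw [windowed, ← integral_const_mul]
  refine integral_congr_ae (ae_of_all _ fun ξ => ?_)
  simp only
  rw [add_comm η]
  ring

end Window

/-! ### Decay of windowed symbols of regular nets -/

section Decay

open scoped FourierTransform

variable {Ω : Opens (RSp d)}

theorem one_div_toReal_one_sub_nonneg {p : ℝ≥0∞} (hp : 1 ≤ p) :
    0 ≤ 1 / (1 : ℝ≥0∞).toReal - 1 / p.toReal := by
  rcases eq_or_ne p ⊤ with rfl | hp'
  · simp
  · have : 1 ≤ p.toReal := by
      rw [← ENNReal.toReal_one]
      exact ENNReal.toReal_mono hp' hp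
    rw [ENNReal.toReal_one, div_one, sub_nonneg]
    exact (div_le_one (by linarith)).2 this

/-- The Fourier transform of a cut-off function is bounded by Sobolev norms. -/
theorem fourier_cutoff_smul_le {p : ℝ≥0∞} (hp : 1 ≤ p) (θ : 𝓓(Ω, ℝ)) {V : Opens (RSp d)}
    (hθ : tsupport θ ⊆ V) (hV : volume (V : Set (RSp d)) < ⊤) (k : ℕ) :
    ∃ C : ℝ≥0, ∀ g : RSp d → ℂ, ContDiff ℝ ∞ g → ∀ η,
      ENNReal.ofReal ((1 + ‖η‖) ^ k * ‖𝓕 (fun x => θ x • g x) η‖) ≤ C * sobolevNorm k p V g := by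
  have hbd : ∀ i, ∃ D : ℝ≥0, ∀ x, ‖iteratedFDeriv ℝ i θ x‖ ≤ D := fun i => by
    obtain ⟨D, hD⟩ := (θ.hasCompactSupport.iteratedFDeriv (𝕜 := ℝ) i).exists_bound_of_continuous
      (θ.contDiff.continuous_iteratedFDeriv (by exact_mod_cast le_top))
    exact ⟨D.toNNReal, fun x => (hD x).trans (Real.le_coe_toNNReal D)⟩
  choose D hD using hbd
  set v : ℝ≥0∞ := volume (V : Set (RSp d)) ^ (1 / (1 : ℝ≥0∞).toReal - 1 / p.toReal) with hv
  have hvtop : v ≠ ⊤ := ENNReal.rpow_ne_top_of_nonneg (one_div_toReal_one_sub_nonneg hp) hV.ne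
  -- the constant for the derivative of order `l`
  set B : ℕ → ℝ≥0 := fun l => ∑ i ∈ Finset.range (l + 1), (l.choose i : ℝ≥0) * D i *
    (∑ _m : Fin (l - i) → Fin d, v.toNNReal) with hB
  have hL1 : ∀ g : RSp d → ℂ, ContDiff ℝ ∞ g → ∀ l ≤ k,
      ∫⁻ x, ‖iteratedFDeriv ℝ l (fun x => θ x • g x) x‖ₑ ≤ B l * sobolevNorm k p V g := by
    intro g hg l hl
    have hzero : ∀ x ∉ (V : Set (RSp d)), ‖iteratedFDeriv ℝ l (fun x => θ x • g x) x‖ₑ = 0 := by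
      intro x hx
      have h0 : (fun y => θ y • g y) =ᶠ[nhds x] fun _ => 0 := by
        filter_upwards [notMem_tsupport_iff_eventuallyEq.1 fun h => hx (hθ h)] with y hy
        rw [hy, Pi.zero_apply, zero_smul]
      rw [(h0.iteratedFDeriv ℝ l).eq_of_nhds, iteratedFDeriv_fun_zero]
      simp
    rw [← setLIntegral_eq_of_support_subset (s := (V : Set (RSp d))) fun x hx => by
      by_contra h; exact hx (hzero x h)]
    have hpt : ∀ x, ‖iteratedFDeriv ℝ l (fun x => θ x • g x) x‖ₑ ≤
        ∑ i ∈ Finset.range (l + 1), ((l.choose i : ℝ≥0) * D i : ℝ≥0) *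
          ∑ m : Fin (l - i) → Fin d, ‖pderiv m g x‖ₑ := by
      intro x
      have h1 : ‖iteratedFDeriv ℝ l (fun x => θ x • g x) x‖ ≤
          ∑ i ∈ Finset.range (l + 1), ((l.choose i : ℝ) * D i) *
            ∑ m : Fin (l - i) → Fin d, ‖pderiv m g x‖ := by
        refine (norm_iteratedFDeriv_cutoff_smul_le θ.contDiff hg l x).trans
          (Finset.sum_le_sum fun i _ => ?_)
        gcongr
        · exact hD i x
        · exact norm_le_sum_single _
      have h2 : ‖iteratedFDeriv ℝ l (fun x => θ x • g x) x‖₊ ≤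
          ∑ i ∈ Finset.range (l + 1), ((l.choose i : ℝ≥0) * D i) *
            ∑ m : Fin (l - i) → Fin d, ‖pderiv m g x‖₊ := by
        rw [← NNReal.coe_le_coe]
        push_cast
        exact h1
      have h3 := ENNReal.coe_le_coe.2 h2
      push_cast at h3
      push_cast
      exact h3
    have hmeas : ∀ (i : ℕ) (m : Fin i → Fin d), Continuous (pderiv m g) := fun i m =>
      (ContinuousMultilinearMap.apply ℝ (fun _ : Fin i => RSp d) ℂ
        (fun i => EuclideanSpace.single (m i) (1 : ℝ))).continuous.comp
        (hg.continuous_iteratedFDeriv (by exact_mod_cast le_top))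
    refine (lintegral_mono hpt).trans ?_
    rw [lintegral_finsetSum' _ fun i _ => AEMeasurable.const_mul
      (Finset.aemeasurable_fun_sum _ fun m _ => (hmeas _ m).enorm.measurable.aemeasurable) _, hB]
    push_cast
    rw [Finset.sum_mul]
    refine Finset.sum_le_sum fun i hi => ?_
    rw [lintegral_const_mul' _ _ (by finiteness), mul_assoc _ _ (sobolevNorm k p V g)]
    gcongr
    rw [lintegral_finsetSum' _ fun m _ => (hmeas _ m).enorm.measurable.aemeasurable,
      Finset.sum_mul]
    refine Finset.sum_le_sum fun m _ => ?_
    rw [ENNReal.coe_toNNReal hvtop, ← eLpNorm_one_eq_lintegral_enorm, mul_comm]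
    refine (eLpNorm_le_eLpNorm_mul_rpow_measure_univ hp
      (hmeas _ m).aestronglyMeasurable).trans ?_
    rw [Measure.restrict_apply_univ]
    gcongr
    exact le_sobolevNorm (⟨l - i, by omega⟩ : Fin (k + 1)) m p V g
  set A : ℝ≥0 := ∑ l ∈ Finset.range (k + 1), B l with hA
  refine ⟨2 ^ k * (2 * (2 ^ k * A)), fun g hg η => ?_⟩
  have hcs : HasCompactSupport fun x => θ x • g x := θ.hasCompactSupport.smul_right
  have hf : ContDiff ℝ ∞ fun x => θ x • g x := θ.contDiff.smul hg
  have hint : ∀ l : ℕ, Integrable (iteratedFDeriv ℝ l fun x => θ x • g x) := fun l =>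
    (hf.continuous_iteratedFDeriv (by exact_mod_cast le_top)).integrable_of_hasCompactSupport
      (hcs.iteratedFDeriv l)
  have hpow : ∀ n ≤ k, ENNReal.ofReal (‖η‖ ^ n * ‖𝓕 (fun x => θ x • g x) η‖) ≤
      2 ^ k * A * sobolevNorm k p V g := by
    intro n hn
    have h1 := Real.pow_mul_norm_iteratedFDeriv_fourier_le (K := 0) (N := ⊤) hf
      (fun a b ha _ => by
        obtain rfl : a = 0 := by simpa using ha
        simpa using (hint b).norm) (k := 0) (n := n) le_rfl le_top η
    simp only [norm_iteratedFDeriv_zero, pow_zero, one_mul, Nat.cast_zero, mul_zero, zero_add,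
      Finset.range_one, Finset.singleton_product, Finset.sum_map, Function.Embedding.coeFn_mk]
      at h1
    refine (ENNReal.ofReal_le_ofReal h1).trans ?_
    rw [ENNReal.ofReal_mul (by positivity), ENNReal.ofReal_pow (by positivity),
      ENNReal.ofReal_ofNat, ENNReal.ofReal_sum_of_nonneg
        fun l _ => integral_nonneg fun x => norm_nonneg _, hA, mul_assoc]
    gcongr
    · norm_num
    · push_cast
      rw [Finset.sum_mul]
      refine (Finset.sum_le_sum_of_subset (Finset.range_mono (Nat.succ_le_succ hn))).trans
        (Finset.sum_le_sum fun l hl => ?_)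
      rw [ofReal_integral_norm_eq_lintegral_enorm (hint l)]
      exact hL1 g hg l (Nat.lt_succ_iff.1 (Finset.mem_range.1 hl))
  have h2 : (1 + ‖η‖) ^ k * ‖𝓕 (fun x => θ x • g x) η‖ ≤
      2 ^ k * (‖η‖ ^ 0 * ‖𝓕 (fun x => θ x • g x) η‖ +
        ‖η‖ ^ k * ‖𝓕 (fun x => θ x • g x) η‖) := by
    have h3 : (1 + ‖η‖) ^ k ≤ 2 ^ k * (1 + ‖η‖ ^ k) := by
      refine (add_pow_le zero_le_one (norm_nonneg _) k).trans ?_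
      rw [one_pow]
      gcongr
      · norm_num
      · omega
    calc _ ≤ 2 ^ k * (1 + ‖η‖ ^ k) * ‖𝓕 (fun x => θ x • g x) η‖ := by gcongr
      _ = _ := by ring
  refine (ENNReal.ofReal_le_ofReal h2).trans ?_
  rw [ENNReal.ofReal_mul (by positivity), ENNReal.ofReal_add (by positivity) (by positivity),
    ENNReal.ofReal_pow (by positivity), ENNReal.ofReal_ofNat]
  push_cast
  rw [mul_assoc, mul_assoc, two_mul]
  gcongr
  · exact hpow 0 (Nat.zero_le _)
  · exact hpow k le_rfl

theorem dlog_Ioo_bounds {δ : ℝ} (hδ : 0 < δ) (hδ' : δ ≤ 1 / 2) :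
    1 / 2 ≤ dlog (Ioo δ (2 * δ)) ∧ dlog (Ioo δ (2 * δ)) ≤ 1 := by
  have hsub : Ioo δ (2 * δ) ⊆ Ioo 0 1 := fun ε hε => ⟨hδ.trans hε.1, by linarith [hε.2]⟩
  have h : dlog (Ioo δ (2 * δ)) = ∫⁻ ε in Ioo δ (2 * δ), ENNReal.ofReal ε⁻¹ := by
    rw [dlog, withDensity_apply _ measurableSet_Ioo, Measure.restrict_restrict measurableSet_Ioo,
      inter_eq_self_of_subset_left hsub]
  have hvol : volume (Ioo δ (2 * δ)) = ENNReal.ofReal δ := by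
    rw [Real.volume_Ioo]; congr 1; ring
  rw [h]
  constructor
  · calc (1 / 2 : ℝ≥0∞) = ∫⁻ ε in Ioo δ (2 * δ), ENNReal.ofReal (2 * δ)⁻¹ := by
          rw [setLIntegral_const, hvol, ← ENNReal.ofReal_mul (by positivity)]
          have : (2 * δ)⁻¹ * δ = 1 / 2 := by field_simp
          rw [this, ENNReal.ofReal_div_of_pos (by norm_num)]
          simp
      _ ≤ _ := by
          refine setLIntegral_mono' measurableSet_Ioo fun ε hε => ?_
          have := hδ.trans hε.1
          exact ENNReal.ofReal_le_ofReal (by gcongr; exact hε.2.le)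
  · calc _ ≤ ∫⁻ ε in Ioo δ (2 * δ), ENNReal.ofReal δ⁻¹ := by
          refine setLIntegral_mono' measurableSet_Ioo fun ε hε => ?_
          exact ENNReal.ofReal_le_ofReal (by gcongr; exact hε.1.le)
      _ = 1 := by
          rw [setLIntegral_const, hvol, ← ENNReal.ofReal_mul (by positivity),
            inv_mul_cancel₀ hδ.ne', ENNReal.ofReal_one]

/-- An `L^q` bound with respect to `dε / ε` gives a uniform bound at some point of every dyadic
interval. -/
theorem exists_le_of_eLpNorm_dlog_lt_top {q : ℝ≥0∞} (hq : 1 ≤ q) {f : ℝ → ℝ≥0∞}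
    (hf : AEMeasurable f dlog) (h : eLpNorm f q dlog < ⊤) :
    ∃ C : ℝ≥0, ∀ δ : ℝ, 0 < δ → δ ≤ 1 / 2 → ∃ ε ∈ Ioo δ (2 * δ), f ε ≤ C := by
  refine ⟨2 * (eLpNorm f q dlog).toNNReal + 1, fun δ hδ hδ' => ?_⟩
  by_contra! hlt
  obtain ⟨hlow, hup⟩ := dlog_Ioo_bounds hδ hδ'
  set ν := dlog.restrict (Ioo δ (2 * δ)) with hν
  have h1 : ∫⁻ ε, f ε ∂ν ≤ eLpNorm f q dlog := by
    have e : ∫⁻ ε, f ε ∂ν = eLpNorm f 1 ν := by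
      rw [eLpNorm_one_eq_lintegral_enorm]; simp
    rw [e]
    refine (eLpNorm_le_eLpNorm_mul_rpow_measure_univ hq
      hf.restrict.aestronglyMeasurable).trans ?_
    rw [Measure.restrict_apply_univ]
    refine (mul_le_mul' (eLpNorm_mono_measure f Measure.restrict_le_self)
      (ENNReal.rpow_le_one hup (one_div_toReal_one_sub_nonneg hq))).trans_eq (mul_one _)
  have h2 : (2 * eLpNorm f q dlog + 1) * (1 / 2) ≤ ∫⁻ ε, f ε ∂ν := by
    calc (2 * eLpNorm f q dlog + 1) * (1 / 2)
        ≤ (2 * eLpNorm f q dlog + 1) * dlog (Ioo δ (2 * δ)) := by gcongr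
      _ = ∫⁻ _ in Ioo δ (2 * δ), (2 * eLpNorm f q dlog + 1) ∂dlog := by rw [setLIntegral_const]
      _ ≤ ∫⁻ ε, f ε ∂ν := by
          refine setLIntegral_mono' measurableSet_Ioo fun ε hε => ?_
          have := (hlt ε hε).le
          push_cast at this
          rwa [ENNReal.coe_toNNReal h.ne] at this
  have h3 : eLpNorm f q dlog < (2 * eLpNorm f q dlog + 1) * (1 / 2) := by
    have e : (2 * eLpNorm f q dlog + 1) * (1 / 2) = eLpNorm f q dlog + 1 / 2 := by
      rw [add_mul, one_mul, mul_comm 2, mul_assoc, one_div,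
        ENNReal.mul_inv_cancel two_ne_zero ENNReal.ofNat_ne_top, mul_one]
    rw [e]
    exact ENNReal.lt_add_right h.ne (by simp)
  exact absurd (h3.trans_le (h2.trans h1)) (lt_irrefl _)

/-- If all Sobolev norms of the regularization grow at one and the same rate, the windowed symbol
is rapidly decreasing. For given `η` the parameter `ε` is chosen of the size of a large negative
power of `1 + ‖η‖`. -/
theorem windowed_rapid_decay {p q : ℝ≥0∞} (hp : 1 ≤ p) (hq : 1 ≤ q) {φ : 𝓢(RSp d, ℂ)}
    (hφ : ∫ x, φ x = 1) (θ : 𝓓(Ω, ℝ)) {Θ : 𝓢(RSp d, ℂ)} (hΘ : ∀ x, Θ x = θ x)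
    {V : Opens (RSp d)} (hθ : tsupport θ ⊆ V) (hV : volume (V : Set (RSp d)) < ⊤) {P : ℕ}
    {H : RSp d → ℂ} (hH : IsSymbol P H) {s : ℝ}
    (hs : ∀ k, growthNorm p q k s V (symbolNet φ H) < ⊤) (n : ℕ) :
    ∃ C, 0 ≤ C ∧ ∀ η, (1 + ‖η‖) ^ n * ‖windowed Θ H η‖ ≤ C := by
  obtain ⟨C₁, hC₁, h₁⟩ := norm_windowed_sub_le hφ Θ hH
  set t := ⌈s⌉₊ with ht
  -- `ε ≤ (1 + ‖η‖) ^ (-a)` absorbs the growth `(1 + ‖η‖) ^ (P + 1)` of the difference, and the order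
  -- `k` of the Sobolev norm then compensates its growth `ε ^ (-t)`
  set a := n + (P + 1) with ha
  set k := n + a * t with hk
  obtain ⟨C₂, h₂⟩ := fourier_cutoff_smul_le hp θ hθ hV k
  have hgrow : growthNorm p q k t V (symbolNet φ H) < ⊤ :=
    (growthNorm_anti (Nat.le_ceil s) _ _).trans_lt (hs k)
  obtain ⟨C₃, h₃⟩ := exists_le_of_eLpNorm_dlog_lt_top hq
    (((isSmoothNet_symbolNet φ hH).mono le_top).aemeasurable_weight p k t) hgrow
  refine ⟨C₁ + C₂ * C₃ * 2 ^ t, by positivity, fun η => ?_⟩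
  set r := 1 + ‖η‖ with hr
  have hr1 : 1 ≤ r := by rw [hr]; linarith [norm_nonneg η]
  have hr0 : 0 < r := by linarith
  have hra : (r ^ a)⁻¹ ≤ 1 := inv_le_one_of_one_le₀ (one_le_pow₀ hr1)
  obtain ⟨ε, hε, hle⟩ := h₃ ((r ^ a)⁻¹ / 2) (by positivity) (by linarith)
  have hεup : ε ≤ (r ^ a)⁻¹ := by linarith [hε.2]
  have hε0 : 0 < ε := lt_trans (by positivity) hε.1
  have hε1 : ε ∈ Ioo (0 : ℝ) 1 := ⟨hε0, by linarith [hε.2]⟩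
  set We := windowed Θ (fun ξ => H ξ * (𝓕 φ : 𝓢(RSp d, ℂ)) (-(ε • ξ))) η with hWe
  have hpart1 : r ^ n * ‖windowed Θ H η - We‖ ≤ C₁ := by
    calc r ^ n * ‖windowed Θ H η - We‖ ≤ r ^ n * (C₁ * ε * r ^ (P + 1)) := by
          gcongr; exact h₁ ε hε1 η
      _ ≤ r ^ n * (C₁ * (r ^ a)⁻¹ * r ^ (P + 1)) := by gcongr
      _ = C₁ := by
          rw [ha, pow_add]
          field_simp
  have hWe' : We = 𝓕 (fun x => θ x • symbolNet φ H ε x) η := by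
    rw [hWe, ← fourier_window_mul_fourier]
    · have e : (fun x => Θ x * 𝓕 (fun ξ => H ξ * (𝓕 φ : 𝓢(RSp d, ℂ)) (-(ε • ξ))) x) =
          fun x => θ x • symbolNet φ H ε x := by
        funext x
        rw [hΘ, Complex.real_smul]
        rfl
      rw [e]
    · have := integrable_symbol_mul φ hH hε1 0
      simp only [pow_zero, one_mul] at this
      exact (integrable_norm_iff
        (aestronglyMeasurable_symbol_mul φ hH.aestronglyMeasurable ε)).1 this
  have hpart2 : ε ^ t * (r ^ k * ‖We‖) ≤ C₂ * C₃ := by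
    have h4 := h₂ _ (contDiff_symbolNet φ hH hε1) η
    rw [← hWe'] at h4
    have h5 : ENNReal.ofReal (ε ^ t * (r ^ k * ‖We‖)) ≤ ENNReal.ofReal (C₂ * C₃) := by
      rw [ENNReal.ofReal_mul (by positivity), ENNReal.ofReal_mul (p := C₂) (by positivity),
        ENNReal.ofReal_coe_nnreal, ENNReal.ofReal_coe_nnreal]
      rw [Real.rpow_natCast] at hle
      calc _ ≤ ENNReal.ofReal (ε ^ t) * (C₂ * sobolevNorm k p V (symbolNet φ H ε)) := by gcongr
        _ = C₂ * (ENNReal.ofReal (ε ^ t) * sobolevNorm k p V (symbolNet φ H ε)) := by ring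
        _ ≤ C₂ * C₃ := by gcongr
    exact (ENNReal.ofReal_le_ofReal_iff (by positivity)).1 h5
  have hpart2' : r ^ n * ‖We‖ ≤ C₂ * C₃ * 2 ^ t := by
    have h6 : 1 ≤ 2 ^ t * ε ^ t * (r ^ a) ^ t := by
      rw [← mul_pow, ← mul_pow]
      refine one_le_pow₀ ?_
      have := mul_le_mul_of_nonneg_right hε.1.le (by positivity : (0 : ℝ) ≤ r ^ a)
      rw [div_mul_eq_mul_div, inv_mul_cancel₀ (by positivity)] at this
      linarith
    calc r ^ n * ‖We‖ ≤ (2 ^ t * ε ^ t * (r ^ a) ^ t) * (r ^ n * ‖We‖) :=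
          le_mul_of_one_le_left (by positivity) h6
      _ = ε ^ t * (r ^ k * ‖We‖) * 2 ^ t := by
          rw [hk, pow_add r n (a * t), pow_mul]; ring
      _ ≤ _ := by gcongr
  calc r ^ n * ‖windowed Θ H η‖ ≤ r ^ n * (‖windowed Θ H η - We‖ + ‖We‖) := by
        gcongr
        exact norm_le_norm_sub_add _ _
    _ ≤ _ := by rw [mul_add]; exact add_le_add hpart1 hpart2'

end Decay

/-! ### Smoothness of distributions with regular image -/

section Regularity

open scoped FourierTransform

variable {Ω : Opens (RSp d)}

/-- A real test function as a complex Schwartz function. -/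
noncomputable def toSchwartz (ρ : 𝓓(Ω, ℝ)) : 𝓢(RSp d, ℂ) :=
  HasCompactSupport.toSchwartzMap (f := fun x => (ρ x : ℂ))
    (ρ.hasCompactSupport.comp_left (g := ((↑) : ℝ → ℂ)) Complex.ofReal_zero)
    (Complex.ofRealCLM.contDiff.comp ρ.contDiff)

theorem toSchwartz_apply (ρ : 𝓓(Ω, ℝ)) (x : RSp d) : toSchwartz ρ x = ρ x := rfl

theorem localized_toSchwartz (T : 𝓓'(Ω, ℂ)) {χ ρ : 𝓓(Ω, ℝ)} (h : ∀ x, χ x * ρ x = ρ x) :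
    localized T χ (toSchwartz ρ) = T ρ := by
  change pairing T _ = _
  have h1 : TestFunction.postcompCLM Complex.reCLM (cutoffMul χ (toSchwartz ρ)) = ρ := by
    ext x
    change (χ x • (ρ x : ℂ)).re = ρ x
    rw [Complex.real_smul, ← Complex.ofReal_mul, Complex.ofReal_re, h]
  have h2 : TestFunction.postcompCLM Complex.imCLM (cutoffMul χ (toSchwartz ρ)) = 0 := by
    ext x
    change (χ x • (ρ x : ℂ)).im = 0
    rw [Complex.real_smul, ← Complex.ofReal_mul, Complex.ofReal_im]
  rw [pairing, h1, h2, map_zero, mul_zero, add_zero]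

theorem integrable_pow_mul_of_rapid_decay {W : RSp d → ℂ} (hm : AEStronglyMeasurable W volume)
    (hW : ∀ n : ℕ, ∃ C, 0 ≤ C ∧ ∀ η, (1 + ‖η‖) ^ n * ‖W η‖ ≤ C) (n : ℕ) :
    Integrable fun η => ‖η‖ ^ n * ‖W η‖ := by
  obtain ⟨C, hC, h⟩ := hW (n + (d + 1))
  have hint : Integrable fun η : RSp d => (1 + ‖η‖) ^ (-(d + 1 : ℝ)) :=
    integrable_one_add_norm (by simp)
  refine (hint.const_mul C).mono' ((Continuous.aestronglyMeasurable (by fun_prop)).mul hm.norm)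
    (ae_of_all _ fun η => ?_)
  rw [Real.norm_of_nonneg (by positivity), Real.rpow_neg (by positivity),
    show (d + 1 : ℝ) = ((d + 1 : ℕ) : ℝ) by push_cast; ring, Real.rpow_natCast,
    ← div_eq_mul_inv, le_div_iff₀ (by positivity)]
  refine le_trans ?_ (h η)
  have h1 : ‖η‖ ^ n ≤ (1 + ‖η‖) ^ n := by gcongr; linarith
  calc ‖η‖ ^ n * ‖W η‖ * (1 + ‖η‖) ^ (d + 1)
      ≤ (1 + ‖η‖) ^ n * ‖W η‖ * (1 + ‖η‖) ^ (d + 1) := by gcongr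
    _ = _ := by rw [pow_add]; ring

/-- If all derivatives of `(χ T) ∗ φ_ε` grow at one and the same rate near the support of `θ`,
then `T` is smooth on the set where `χ = θ = 1`: there it is given by the inverse Fourier transform
of the windowed symbol of `χ T`. -/
theorem exists_contDiff_of_growthNorm {p q : ℝ≥0∞} (hp : 1 ≤ p) (hq : 1 ≤ q) {φ : 𝓢(RSp d, ℂ)}
    (hφ : ∫ x, φ x = 1) (T : 𝓓'(Ω, ℂ)) (χ θ : 𝓓(Ω, ℝ)) {V : Opens (RSp d)}
    (hθ : tsupport θ ⊆ V) (hV : volume (V : Set (RSp d)) < ⊤) {s : ℝ}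
    (hs : ∀ k, growthNorm p q k s V (mollifiedNet φ χ T) < ⊤) :
    ∃ h : RSp d → ℂ, ContDiff ℝ ∞ h ∧ ∀ ρ : 𝓓(Ω, ℝ), (∀ x, χ x * ρ x = ρ x) →
      (∀ x, θ x * ρ x = ρ x) → T ρ = ∫ x, ρ x • h x := by
  obtain ⟨P, H, hH, hrep⟩ := exists_symbol T χ
  have hs' : ∀ k, growthNorm p q k s V (symbolNet φ H) < ⊤ := fun k =>
    (growthNorm_congr (fun ε hε => by
      rw [mollifiedNet_eq_symbolNet φ hrep hε.1]; exact fun _ _ => rfl) p q k s).trans_lt (hs k)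
  set W := windowed (toSchwartz θ) H with hW
  have hdec := windowed_rapid_decay hp hq hφ θ (toSchwartz_apply θ) hθ hV hH hs'
  have hWm : AEStronglyMeasurable W volume := aestronglyMeasurable_windowed _ hH.aestronglyMeasurable
  have hWi := integrable_pow_mul_of_rapid_decay hWm hdec
  have hWi' : ∀ n : ℕ, Integrable fun η : RSp d => ‖η‖ ^ n * ‖W (-η)‖ := fun n => by
    have := (hWi n).comp_neg
    simpa using this
  have hW0 : Integrable fun η => W (-η) := by
    have h0 := hWi 0
    simp only [pow_zero, one_mul] at h0
    exact ((integrable_norm_iff hWm).1 h0).comp_neg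
  refine ⟨𝓕 fun η => W (-η), Real.contDiff_fourier (N := ⊤) fun n _ => hWi' n,
    fun ρ hχρ hθρ => ?_⟩
  set σ : 𝓢(RSp d, ℂ) := 𝓕⁻ (toSchwartz ρ) with hσ
  have hσ' : 𝓕 (σ : RSp d → ℂ) = toSchwartz ρ := by
    rw [← SchwartzMap.fourier_coe, hσ, FourierTransform.fourier_fourierInv_eq]
  have h1 : (fun x => toSchwartz θ x * 𝓕 (σ : RSp d → ℂ) x) = toSchwartz ρ := by
    funext x
    rw [hσ', toSchwartz_apply, toSchwartz_apply, ← Complex.ofReal_mul, hθρ]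
  have h2 := integral_mul_fourier_window_mul (toSchwartz θ) σ hH
  rw [h1] at h2
  rw [← localized_toSchwartz T hχρ, hrep]
  calc ∫ ξ, H ξ * (𝓕 (toSchwartz ρ) : 𝓢(RSp d, ℂ)) ξ
      = ∫ η, σ η * W η := by rw [← h2, SchwartzMap.fourier_coe]
    _ = ∫ η, σ (-η) * W (-η) := (integral_neg_eq_self (fun η => σ η * W η) volume).symm
    _ = ∫ η, 𝓕 (toSchwartz ρ : RSp d → ℂ) η * W (-η) := by
        refine integral_congr_ae (ae_of_all _ fun η => ?_)
        simp only
        rw [hσ, SchwartzMap.fourierInv_coe, Real.fourierInv_eq_fourier_neg, neg_neg]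
    _ = ∫ x, toSchwartz ρ x * 𝓕 (fun η => W (-η)) x :=
        integral_fourier_mul_eq_integral_mul_fourier (toSchwartz ρ).integrable hW0
    _ = ∫ x, ρ x • 𝓕 (fun η => W (-η)) x := by
        refine integral_congr_ae (ae_of_all _ fun x => ?_)
        simp only
        rw [toSchwartz_apply, Complex.real_smul]

/-- Continuous functions that represent the same distribution on `U` agree on `U`. -/
theorem eqOn_of_forall_integral_eq {U : Opens (RSp d)} (hU : U ≤ Ω) {f g : RSp d → ℂ}
    (hf : Continuous f) (hg : Continuous g)
    (h : ∀ ρ : 𝓓(Ω, ℝ), tsupport ρ ⊆ U → ∫ x, ρ x • f x = ∫ x, ρ x • g x) : EqOn f g U := by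
  have hae : ∀ᵐ x ∂volume, x ∈ (U : Set (RSp d)) → (f - g) x = 0 := by
    refine U.isOpen.ae_eq_zero_of_integral_contDiff_smul_eq_zero
      ((hf.sub hg).locallyIntegrable.locallyIntegrableOn _) fun ρ hρ hc hsub => ?_
    have := h ⟨ρ, hρ, hc, hsub.trans hU⟩ hsub
    simp only [Pi.sub_apply, smul_sub]
    rw [integral_sub, sub_eq_zero]
    · exact this
    · exact (hρ.continuous.smul hf).integrable_of_hasCompactSupport hc.smul_right
    · exact (hρ.continuous.smul hg).integrable_of_hasCompactSupport hc.smul_right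
  refine Measure.eqOn_open_of_ae_eq (μ := volume) ?_ U.isOpen hf.continuousOn hg.continuousOn
  filter_upwards [ae_restrict_of_ae hae, ae_restrict_mem U.isOpen.measurableSet] with x hx hxU
  exact sub_eq_zero.1 (hx hxU)

theorem mem_smoothDistributions_of_iota_mem_GInfty {p q : ℝ≥0∞} (hp : 1 ≤ p) (hq : 1 ≤ q)
    {φ : 𝓢(RSp d, ℂ)} (hφ : ∫ x, φ x = 1) {T : 𝓓'(Ω, ℂ)} (hT : iota p q φ T ∈ GInfty p q Ω) :
    T ∈ smoothDistributions Ω := by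
  obtain ⟨E⟩ := nonempty_cutoffExhaustion Ω
  have hloc : ∀ N, ∃ h : RSp d → ℂ, ContDiff ℝ ∞ h ∧ ∀ ρ : 𝓓(Ω, ℝ),
      tsupport ρ ⊆ E.U N → T ρ = ∫ x, ρ x • h x := by
    intro N
    obtain ⟨s, hs⟩ := hT (E.U (N + 2)) ((E.relCompact (N + 2)).mono (E.le _))
    obtain ⟨hmod, hF⟩ := isEmbeddingOf_iota (p := p) hq φ T (E.U (N + 2)) (E.le _) (E.χ (N + 2))
      (E.eq_one _)
    have hgrow : ∀ k, growthNorm p q k s (E.U (N + 1)) (mollifiedNet φ (E.χ (N + 2)) T) < ⊤ := by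
      intro k
      obtain ⟨f, hf, hfeq⟩ := hs k
      rw [hF, GSpace.mk_eq_mk_iff] at hfeq
      have hle := (E.relCompact (N + 1)).le
      have := growthNorm_add_lt_top (f.2.1.mono hle) (hfeq.1.mono hle)
        (hf _ (E.relCompact (N + 1))) (hfeq.2 k _ (E.relCompact (N + 1)) s)
      simpa using this
    obtain ⟨h, hh, hrep⟩ := exists_contDiff_of_growthNorm hp hq hφ T (E.χ (N + 2)) (E.χ N)
      (E.tsupport_subset N) (E.relCompact (N + 1)).volume_lt_top hgrow
    refine ⟨h, hh, fun ρ hρ => ?_⟩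
    have hone : ∀ n, N ≤ n → ∀ x, E.χ n x * ρ x = ρ x := by
      intro n hn x
      by_cases hx : x ∈ tsupport ρ
      · rw [E.eq_one n x (E.monotone hn (hρ hx)), one_mul]
      · rw [image_eq_zero_of_notMem_tsupport hx, mul_zero]
    exact hrep ρ (hone _ (Nat.le_add_right N 2)) (hone N le_rfl)
  choose h hh hrep using hloc
  obtain ⟨f, hf⟩ := exists_glue (U := fun n => (E.U n : Set (RSp d)))
    (fun _ _ h => E.monotone h) (g := h) fun N =>
      eqOn_of_forall_integral_eq (E.le N) (hh (N + 1)).continuous (hh N).continuous fun ρ hρ => by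
        rw [← hrep N ρ hρ, ← hrep (N + 1) ρ (hρ.trans (E.monotone (Nat.le_succ N)))]
  have hfs : ContDiffOn ℝ ∞ f Ω := by
    intro x hx
    obtain ⟨n, hn⟩ := E.cover x hx
    exact ((hh n).contDiffAt.congr_of_eventuallyEq
      (Filter.eventuallyEq_of_mem ((E.U n).isOpen.mem_nhds hn) (hf n))).contDiffWithinAt
  refine ⟨f, hfs, ?_⟩
  ext ρ
  rw [toDistribution_apply hfs.continuousOn]
  obtain ⟨n, hn⟩ := IsCompact.elim_directed_cover ρ.hasCompactSupport
    (fun n => (E.U n : Set (RSp d))) (fun n => (E.U n).isOpen)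
    (fun x hx => mem_iUnion.2 (E.cover x (ρ.tsupport_subset hx)))
    (directed_of_isDirected_le fun _ _ h => E.monotone h)
  rw [hrep n ρ hn]
  refine integral_congr_ae (ae_of_all _ fun x => ?_)
  by_cases hx : x ∈ tsupport ρ
  · simp only
    rw [hf n (hn hx)]
  · simp only
    rw [image_eq_zero_of_notMem_tsupport hx, zero_smul, zero_smul]

end Regularity

end LqColombeau

open LqColombeau in
theorem mainTheorem4 (d : ℕ) (Ω : Opens (RSp d)) (p q : ℝ≥0∞) (hp : 1 ≤ p) (hq : 1 ≤ q)
    (φ : 𝓢(RSp d, ℂ)) (hφ : IsMollifier φ) :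
    (∀ (T : 𝓓'(Ω, ℂ)) (u : GSpace p q Ω), u = iota p q φ T ↔ IsEmbeddingOf φ T u) ∧
    range (iota p q φ) ∩ GInfty p q Ω = iota p q φ '' smoothDistributions Ω ∧
    (∀ T : 𝓓'(Ω, ℂ), iota p q φ T ∈ GInfty p q Ω → T ∈ smoothDistributions Ω) := by
  have hreg : ∀ T : 𝓓'(Ω, ℂ), iota p q φ T ∈ GInfty p q Ω → T ∈ smoothDistributions Ω :=
    fun T hT => mem_smoothDistributions_of_iota_mem_GInfty hp hq hφ.integral_eq_one hT
  refine ⟨fun T u => eq_iota_iff hq φ T u, ?_, hreg⟩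
  ext u
  constructor
  · rintro ⟨⟨T, rfl⟩, hT⟩
    exact ⟨T, hreg T hT, rfl⟩
  · rintro ⟨T, hT, rfl⟩
    exact ⟨⟨T, rfl⟩, iota_mem_GInfty hq φ hT⟩
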